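/- Let $k$ be a field, $q\in k^\times$ with $q\neq1$, let $e\in\{2,3,\dots\}\cup\{\infty\}$ be the multiplicative order of $q$, and represent residues by $\{1,\dots,e\}$ (by $\mathbb Z$ if $e=\infty$) with the usual order of integers. Let $n\ge2$, $W=S_n$ with simple transpositions $s_r=(r,r+1)$, $r\in\mathbb I=\{1,\dots,n-1\}$, and length $\ell$. For $J\subseteq K\subseteq\mathbb I$ let $W_J=\langle s_r:r\in J\rangle$ and let $D^K_{\emptyset,J}$ be the set of minimal length representatives of $W_K/W_J$. *Hecke and Schur algebras.* Let $H$ be the $k$-algebra with generators $T_r$ ($r\in\mathbb I$), $X_j^{\pm1}$ ($1\le j\le n$) and relations: $(T_r-q)(T_r+1)=0$, the braid relations, the $X_j^{\pm1}$ commute and $X_jX_j^{-1}=X_j^{-1}X_j=1$, $T_rX_j=X_jT_r$ for $j\ne r,r+1$, and $T_rX_rT_r=qX_{r+1}$. Let $T_w$ ($w\in W$) be the product of the $T_r$ along a reduced expression. Let $\sharp$ be the algebra endomorphism $T_r\mapsto q-1-T_r$, $X_j\mapsto X_j^{-1}$, and $v_J=\sum_{w\in W_J}T_w$. Fix a sequence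 of residues $\mathbf i=(i_1,\dots,i_n)$, with orbit $W\mathbf i$ under $(w\cdot u)_j=u_{w^{-1}(j)}$, and let $\widehat H$ be the completion of $H$ at the powers of the two-sided ideal generated by the symmetric Laurent polynomials in $X_1,\dots,X_n$ that vanish at $(q^{i_1},\dots,q^{i_n})$. The completed twisted Schur algebra is $\widehat S=\mathrm{End}_{\widehat H}\big(\bigoplus_{J\subseteq\mathbb I}v_J^\sharp\widehat H\big)$ (right modules). For $J\subseteq K$, $\mathbf b^1_{K,J}$ denotes its element that sends $v_J^\sharp$ to $\sum_{w\in W_KW_J}T_w^\sharp\in v_K^\sharp\widehat H$ and vanishes on the summands other than that of $J$. *Representation.* $\widehat H$ acts on $\widehat P=\bigoplus_{u\in W\mathbf i}k[[X_1-q^{u_1},\dots,X_n-q^{u_n}]]e_u$ as follows: $X_j$ acts by multiplication, $W$ permutes variables and idempotents by $w(fe_u)=w(f)e_{w\cdot u}$, and $(T_r+1)f=\frac{qX_{r+1}-X_r}{X_{r+1}-X_r}(f-s_rf)$; elements of $\widehat H$ act by continuity. For $J\subseteq\mathbb I$ let $U_J$ be the set of $u\in W\mathbf i$ with $u_r\le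 u_{r+1}$ for all $r\in J$. For $u\in U_J$ put $I_u=\{r\in J:u_r=u_{r+1}\}$ and let $\widehat R_{+,u}\subset\widehat P$ be the image of the $W_{I_u}$-invariants of $k[[X_1-q^{u_1},\dots,X_n-q^{u_n}]]$ under $g\mapsto\sum_{w\in D^J_{\emptyset,I_u}}w(g)e_{w\cdot u}$. The twisted completed faithful representation of $\widehat S$ is $\bigoplus_{J}\bigoplus_{u\in U_J}\widehat R_{+,u}\,\overline v^{(J)}$; if $\varphi\in\widehat S$ satisfies $\varphi(v_J^\sharp)=\sum_Kh_Kv_J^\sharp$ with $h_Kv_J^\sharp\in v_K^\sharp\widehat H$, $h_K\in\widehat H$, then $\widehat{\overline\rho}(\varphi)(f\overline v^{(J)})=\sum_K(h_Kf)\overline v^{(K)}$. **Statement.** Let $K=\mathbb I$, $a\in\mathbb I$, $J=\mathbb I\setminus\{a\}$. Let $u_J\in U_J$, and let $u_K$ be the weakly increasing sequence in $W\mathbf i$. For a residue $c$ let $d_c$ be the number of entries $c$ in $u_K$, and let $a_c$, $b_c$ be the numbers of entries $c$ of $u_J$ in the positions $1,\dots,a$ and $a+1,\dots,n$ respectively.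 Let $\sigma$ be the element of minimal length among the $w\in W$ with $w\cdot u_J=u_K$. Put $$\theta_{l,k}=\frac{qX_l-X_k}{X_l-X_k},\qquad \pitchfork^{(d_c)}_{(a_c,b_c)}=\sum_{w\in D^{K'}_{\emptyset,J'}}w,$$ where $W_{K'}$ is the Young subgroup of type $(d_1,d_2,\dots)$ and $W_{J'}$ the Young subgroup of type $(a_1,b_1,a_2,b_2,\dots)$ (residues in increasing order). Then $\mathbf b^1_{K,J}$ exists and is unique, and for every $f\in\widehat R_{+,u_J}$ the element $\widehat{\overline\rho}(\mathbf b^1_{K,J})(f\overline v^{(J)})$ lies in the twisted completed faithful representation and satisfies $$e_{u_K}\,\widehat{\overline\rho}(\mathbf b^1_{K,J})\,f\,\overline v^{(J)}=e_{u_K}\,\pitchfork^{(d_c)}_{(a_c,b_c)}\;\sigma\Big(\prod_{k=a+1}^{n}\prod_{l=1}^{a}\theta_{l,k}\;f\Big)\overline v^{(K)}.$$ This is an equality in the field of fractions of the power series ring at $u_K$; in particular the components in the other $\overline v^{(L)}$, $L\ne K$, at $e_{u_K}$ vanish. -/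

import Mathlib

namespace AffineSchur

noncomputable section

/-! ### Permutations, lengths and parabolic subgroups -/

/-- The simple transposition exchanging the neighbouring positions `r` and `r + 1`. -/
def s {m : ℕ} (r : Fin m) : Equiv.Perm (Fin (m + 1)) := Equiv.swap r.castSucc r.succ

/-- The words in the simple transpositions whose product is `w`. -/
def wordsOf {m : ℕ} (w : Equiv.Perm (Fin (m + 1))) : Set (List (Fin m)) :=
  {l | (l.map s).prod = w}

/-- The Coxeter length: the least number of simple transpositions with product `w`. -/
def len {m : ℕ} (w : Equiv.Perm (Fin (m + 1))) : ℕ := sInf (List.length '' wordsOf w)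

theorem wordsOf_nonempty {m : ℕ} (w : Equiv.Perm (Fin (m + 1))) : (wordsOf w).Nonempty := by
  have h : w ∈ Submonoid.closure
      (Set.range fun i : Fin m ↦ Equiv.swap i.castSucc i.succ) := by
    rw [Equiv.Perm.mclosure_swap_castSucc_succ]; trivial
  obtain ⟨l, hl, hw⟩ := Submonoid.exists_list_of_mem_closure h
  clear h
  induction l generalizing w with
  | nil => exact ⟨[], by simpa [wordsOf] using hw⟩
  | cons x l ih =>
    obtain ⟨t, ht⟩ := ih (l.prod) (fun y hy => hl y (List.mem_cons_of_mem _ hy)) rfl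
    obtain ⟨r, hr⟩ := hl x List.mem_cons_self
    refine ⟨r :: t, ?_⟩
    have ht' : (t.map s).prod = l.prod := ht
    change ((r :: t).map s).prod = w
    rw [List.map_cons, List.prod_cons, ht', ← hw, List.prod_cons, ← hr]
    rfl

theorem exists_reducedWord {m : ℕ} (w : Equiv.Perm (Fin (m + 1))) :
    ∃ l : List (Fin m), (l.map s).prod = w ∧ l.length = len w := by
  obtain ⟨l, hl, h⟩ := Nat.sInf_mem ((wordsOf_nonempty w).image List.length)
  exact ⟨l, hl, h⟩

/-- A chosen reduced expression of `w`. -/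
def reducedWord {m : ℕ} (w : Equiv.Perm (Fin (m + 1))) : List (Fin m) :=
  (exists_reducedWord w).choose

/-- The standard parabolic subgroup `W_J` generated by the simple transpositions in `J`. -/
def parabolic {m : ℕ} (J : Finset (Fin m)) : Subgroup (Equiv.Perm (Fin (m + 1))) :=
  Subgroup.closure (s '' (J : Set (Fin m)))

open Classical in
/-- The elements of `W_K` of minimal length in their coset `w W_J` (for `J ⊆ K`: the minimal length
representatives of `W_K / W_J`). -/
def cosetReps {m : ℕ} (K J : Finset (Fin m)) : Finset (Equiv.Perm (Fin (m + 1))) :=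
  Finset.univ.filter fun w => w ∈ parabolic K ∧ ∀ v ∈ parabolic J, len w ≤ len (w * v)

open Classical in
/-- The elements of `W_K W_J` (for `J ⊆ K` or `K ⊆ J` this is the larger one of the two groups). -/
def doubleCosetOne {m : ℕ} (K J : Finset (Fin m)) : Finset (Equiv.Perm (Fin (m + 1))) :=
  Finset.univ.filter fun w => ∃ x ∈ parabolic K, ∃ y ∈ parabolic J, w = x * y

open Classical in
/-- The set of simple transpositions of the Young subgroup `S_{t₁} × S_{t₂} × ⋯`, where
`t = (t₁, t₂, …)`: the positions `r`, `r + 1` (counted from `1`) lie in the same block unless `r`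
is one of the partial sums `t₁ + ⋯ + t_j`. -/
def ofType {m : ℕ} (t : List ℕ) : Finset (Fin m) :=
  Finset.univ.filter fun r => ∀ j, (t.take j).sum ≠ (r : ℕ) + 1

/-! ### Residue sequences -/

/-- Representatives of the exponents `c` of the powers `q ^ c`: the integers `1, …, e` if `q` has
finite order `e`, and all integers otherwise. They are ordered as integers. -/
abbrev Residue {k : Type*} [Field k] (q : kˣ) : Type :=
  {c : ℤ // orderOf q ≠ 0 → 1 ≤ c ∧ c ≤ orderOf q}

theorem Residue.zpow_injective {k : Type*} [Field k] (q : kˣ) :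
    Function.Injective fun c : Residue q => q ^ (c : ℤ) := by
  rintro ⟨c, hc⟩ ⟨d, hd⟩ h
  have h' : q ^ c = q ^ d := h
  rw [zpow_eq_zpow_iff_modEq] at h'
  apply Subtype.ext
  change c = d
  by_cases h0 : orderOf q = 0
  · rw [h0] at h'
    simpa [Int.modEq_zero_iff] using h'
  · have h1 := hc h0
    have h2 := hd h0
    have h3 := (Int.modEq_iff_dvd.mp h')
    obtain ⟨t, ht⟩ := h3
    have : t = 0 := by
      by_contra ht0
      rcases lt_or_gt_of_ne ht0 with h | h
      · nlinarith
      · nlinarith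
    subst this
    linarith

/-- The orbit of the residue sequence `i` under permutations of the positions. -/
abbrev Orb {k : Type*} [Field k] {q : kˣ} {m : ℕ} (i : Fin (m + 1) → Residue q) : Type :=
  {u : Fin (m + 1) → Residue q // ∃ w : Equiv.Perm (Fin (m + 1)), u = i ∘ w}

section

variable {k : Type*} [Field k] {q : kˣ} {m : ℕ} {i : Fin (m + 1) → Residue q}

/-- The left action `(w • u)_j = u_{w⁻¹ j}` on sequences in the orbit. -/
instance : MulAction (Equiv.Perm (Fin (m + 1))) (Orb i) where
  smul w u := ⟨u.1 ∘ (w⁻¹ : Equiv.Perm (Fin (m + 1))), by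
    obtain ⟨v, hv⟩ := u.2
    exact ⟨v * w⁻¹, by rw [hv]; rfl⟩⟩
  one_smul u := Subtype.ext rfl
  mul_smul w v u := by
    apply Subtype.ext
    change u.1 ∘ ((w * v)⁻¹ : Equiv.Perm _) = (u.1 ∘ (v⁻¹ : Equiv.Perm _)) ∘ (w⁻¹ : Equiv.Perm _)
    rw [mul_inv_rev]; rfl

theorem smul_apply (w : Equiv.Perm (Fin (m + 1))) (u : Orb i) (j : Fin (m + 1)) :
    (w • u).1 j = u.1 (w⁻¹ j) := rfl

instance : Finite (Orb i) := by
  refine Finite.of_surjective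
    (fun w : Equiv.Perm (Fin (m + 1)) => (⟨i ∘ w, w, rfl⟩ : Orb i)) ?_
  rintro ⟨u, w, rfl⟩
  exact ⟨w, rfl⟩

instance : Fintype (Orb i) := Fintype.ofFinite _

/-- The sequences in the orbit which are weakly increasing on every block of positions of `J`,
representing the `W_J`-orbits. -/
def U (J : Finset (Fin m)) : Set (Orb i) := {u | ∀ r ∈ J, u.1 r.castSucc ≤ u.1 r.succ}

/-- The simple transpositions in `J` which stabilise `u`. For `u ∈ U J` they generate
the stabiliser of `u` in `W_J`. -/
def stab (J : Finset (Fin m)) (u : Orb i) : Finset (Fin m) :=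
  J.filter fun r => u.1 r.castSucc = u.1 r.succ

end
/-! ### The affine Hecke algebra -/

/-- Generators of the affine Hecke algebra. -/
inductive Gen (m : ℕ) : Type
  | T (r : Fin m) : Gen m
  | X (j : Fin (m + 1)) : Gen m
  | Xinv (j : Fin (m + 1)) : Gen m

section

variable {k : Type*} [Field k] (q : kˣ) (m : ℕ)

/-- The generator `T_r` in the free algebra. -/
abbrev fT {m : ℕ} (r : Fin m) : FreeAlgebra k (Gen m) := FreeAlgebra.ι k (Gen.T r)

/-- The generator `X_j` in the free algebra. -/
abbrev fX {m : ℕ} (j : Fin (m + 1)) : FreeAlgebra k (Gen m) := FreeAlgebra.ι k (Gen.X j)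

/-- The generator `X_j⁻¹` in the free algebra. -/
abbrev fXinv {m : ℕ} (j : Fin (m + 1)) : FreeAlgebra k (Gen m) := FreeAlgebra.ι k (Gen.Xinv j)

/-- The defining relations (Bernstein presentation) of the affine Hecke algebra of `GL_{m+1}`. -/
inductive Rel : FreeAlgebra k (Gen m) → FreeAlgebra k (Gen m) → Prop
  | quad (r : Fin m) :
      Rel ((fT r - algebraMap k _ (q : k)) * (fT r + 1)) 0
  | comm (r t : Fin m) (h : (r : ℕ) + 1 < t) : Rel (fT r * fT t) (fT t * fT r)
  | braid (r t : Fin m) (h : (r : ℕ) + 1 = t) : Rel (fT r * fT t * fT r) (fT t * fT r * fT t)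
  | X_mul_inv (j : Fin (m + 1)) : Rel (fX j * fXinv j) 1
  | inv_mul_X (j : Fin (m + 1)) : Rel (fXinv j * fX j) 1
  | X_comm (j l : Fin (m + 1)) : Rel (fX j * fX l) (fX l * fX j)
  | T_X (r : Fin m) (j : Fin (m + 1)) (h₁ : j ≠ r.castSucc) (h₂ : j ≠ r.succ) :
      Rel (fT r * fX j) (fX j * fT r)
  | T_X_T (r : Fin m) :
      Rel (fT r * fX r.castSucc * fT r) (algebraMap k _ (q : k) * fX r.succ)

/-- The affine Hecke algebra of `GL_{m+1}` with parameter `q`. -/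
abbrev Hecke : Type _ := RingQuot (Rel q m)

variable {m}

/-- The element `T_r`. -/
def hT (r : Fin m) : Hecke q m := RingQuot.mkAlgHom k (Rel q m) (fT r)

/-- The element `X_j`. -/
def hX (j : Fin (m + 1)) : Hecke q m := RingQuot.mkAlgHom k (Rel q m) (fX j)

/-- The element `X_j⁻¹`. -/
def hXinv (j : Fin (m + 1)) : Hecke q m := RingQuot.mkAlgHom k (Rel q m) (fXinv j)

theorem hT_quad (r : Fin m) :
    hT q r * hT q r = algebraMap k _ (q - 1 : k) * hT q r + algebraMap k _ (q : k) := by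
  have h := RingQuot.mkAlgHom_rel k (Rel.quad (q := q) r)
  simp only [map_mul, map_sub, map_add, map_one, map_zero, AlgHom.commutes] at h
  change (hT q r - algebraMap k _ (q : k)) * (hT q r + 1) = 0 at h
  rw [map_sub, map_one, sub_mul, one_mul]
  rw [sub_mul, mul_add, mul_add, mul_one, mul_one] at h
  rw [← sub_eq_zero, ← h]
  abel

theorem hT_comm (r t : Fin m) (h : (r : ℕ) + 1 < t) :
    hT q r * hT q t = hT q t * hT q r := by
  simpa [hT] using RingQuot.mkAlgHom_rel k (Rel.comm (q := q) r t h)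

theorem hT_braid (r t : Fin m) (h : (r : ℕ) + 1 = t) :
    hT q r * hT q t * hT q r = hT q t * hT q r * hT q t := by
  simpa [hT] using RingQuot.mkAlgHom_rel k (Rel.braid (q := q) r t h)

theorem hX_mul_inv (j : Fin (m + 1)) : hX q j * hXinv q j = 1 := by
  simpa [hX, hXinv] using RingQuot.mkAlgHom_rel k (Rel.X_mul_inv (q := q) j)

theorem hX_inv_mul (j : Fin (m + 1)) : hXinv q j * hX q j = 1 := by
  simpa [hX, hXinv] using RingQuot.mkAlgHom_rel k (Rel.inv_mul_X (q := q) j)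

theorem hX_comm (j l : Fin (m + 1)) : hX q j * hX q l = hX q l * hX q j := by
  simpa [hX] using RingQuot.mkAlgHom_rel k (Rel.X_comm (q := q) j l)

theorem hT_X (r : Fin m) (j : Fin (m + 1)) (h₁ : j ≠ r.castSucc) (h₂ : j ≠ r.succ) :
    hT q r * hX q j = hX q j * hT q r := by
  simpa [hX, hT] using RingQuot.mkAlgHom_rel k (Rel.T_X (q := q) r j h₁ h₂)

theorem hT_X_T (r : Fin m) :
    hT q r * hX q r.castSucc * hT q r = algebraMap k _ (q : k) * hX q r.succ := by
  simpa [hX, hT] using RingQuot.mkAlgHom_rel k (Rel.T_X_T (q := q) r)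

/-- The element `X_j` as a unit. -/
def uX (j : Fin (m + 1)) : (Hecke q m)ˣ := ⟨hX q j, hXinv q j, hX_mul_inv q j, hX_inv_mul q j⟩

/-- The images of the generators under the involution: `T_r ↦ q - 1 - T_r`, `X_j ↦ X_j⁻¹`. -/
def hashGen : Gen m → Hecke q m
  | Gen.T r => algebraMap k _ (q - 1 : k) - hT q r
  | Gen.X j => hXinv q j
  | Gen.Xinv j => hX q j

theorem quad_aux {A : Type*} [Ring A] [Algebra k A] (c d : k) (a : A) (hcd : c = d - 1)
    (ha : a * a = algebraMap k A c * a + algebraMap k A d) :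
    (algebraMap k A c - a - algebraMap k A d) * (algebraMap k A c - a + 1) = 0 := by
  subst hcd
  simp only [Algebra.algebraMap_eq_smul_one, sub_mul, mul_sub, mul_add, smul_mul_assoc,
    mul_smul_comm, one_mul, mul_one] at ha ⊢
  rw [ha]
  module

theorem braid_aux {A : Type*} [Ring A] [Algebra k A] (c d : k) (a b : A)
    (ha : a * a = algebraMap k A c * a + algebraMap k A d)
    (hb : b * b = algebraMap k A c * b + algebraMap k A d) (h : a * b * a = b * a * b) :
    (algebraMap k A c - a) * (algebraMap k A c - b) * (algebraMap k A c - a) =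
      (algebraMap k A c - b) * (algebraMap k A c - a) * (algebraMap k A c - b) := by
  simp only [Algebra.algebraMap_eq_smul_one, sub_mul, mul_sub, smul_mul_assoc,
    mul_smul_comm, one_mul, mul_one] at ha hb ⊢
  rw [h, ha, hb]
  module

theorem T_X_T_aux {A : Type*} [Ring A] [Algebra k A] (c : k) (d : kˣ) (a x x' z z' : A)
    (ha : a * a = algebraMap k A c * a + algebraMap k A d)
    (h : a * x * a = algebraMap k A d * z) (hx : x' * x = 1) (hz : z * z' = 1) :
    (algebraMap k A c - a) * x' * (algebraMap k A c - a) = algebraMap k A d * z' := by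
  have e1 : (algebraMap k A c - a) * a = - algebraMap k A d := by rw [sub_mul, ha]; abel
  set b := algebraMap k A c - a
  have e2 : b * x' * b * z = algebraMap k A d := by
    have hu : IsUnit (algebraMap k A d) := RingHom.isUnit_map (algebraMap k A) d.isUnit
    refine hu.mul_left_cancel ?_
    calc algebraMap k A d * (b * x' * b * z) = b * x' * b * (algebraMap k A d * z) := by
          rw [Algebra.commutes, Algebra.commutes (d : k) z]; simp only [mul_assoc]
      _ = b * x' * (b * a) * x * a := by rw [← h]; simp only [mul_assoc]
      _ = - (b * x' * (algebraMap k A d * (x * a))) := by rw [e1]; simp [mul_assoc]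
      _ = - (b * (x' * x) * a * algebraMap k A d) := by
          rw [Algebra.commutes]; simp only [mul_assoc]
      _ = _ := by rw [hx, mul_one, e1]; simp
  calc b * x' * b = b * x' * b * z * z' := by rw [mul_assoc _ z, hz, mul_one]
    _ = _ := by rw [e2]

theorem hash_rel {x y : FreeAlgebra k (Gen m)} (h : Rel q m x y) :
    FreeAlgebra.lift k (hashGen q) x = FreeAlgebra.lift k (hashGen q) y := by
  set c : Hecke q m := algebraMap k _ (q - 1 : k) with hc
  have cc : ∀ x, c * x = x * c := fun x => Algebra.commutes _ x
  have inv_comm : ∀ j l : Fin (m + 1), hXinv q j * hXinv q l = hXinv q l * hXinv q j := by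
    intro j l
    have h1 : Commute (uX q j : Hecke q m) (uX q l) := hX_comm q j l
    exact (h1.units_inv_left).units_inv_right
  cases h with
  | quad r =>
    have h1 := hT_quad q r
    simp only [map_mul, map_sub (FreeAlgebra.lift k (hashGen q)),
      map_add (FreeAlgebra.lift k (hashGen q)), map_one (FreeAlgebra.lift k (hashGen q)),
      map_zero, FreeAlgebra.lift_ι_apply, hashGen, AlgHom.commutes]
    exact quad_aux (q - 1 : k) q (hT q r) rfl h1
  | comm r t h =>
    have h1 := hT_comm q r t h
    simp only [map_mul, FreeAlgebra.lift_ι_apply, hashGen]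
    rw [← hc, sub_mul, sub_mul, mul_sub, mul_sub, mul_sub, mul_sub, h1, cc (hT q r), cc (hT q t)]
    abel
  | braid r t h =>
    simp only [map_mul, FreeAlgebra.lift_ι_apply, hashGen]
    exact braid_aux (q - 1 : k) q _ _ (hT_quad q r) (hT_quad q t) (hT_braid q r t h)
  | X_mul_inv j => simpa [hashGen] using hX_inv_mul q j
  | inv_mul_X j => simpa [hashGen] using hX_mul_inv q j
  | X_comm j l => simpa [hashGen] using inv_comm j l
  | T_X r j h₁ h₂ =>
    have h1 : Commute (hT q r) (uX q j : Hecke q m) := hT_X q r j h₁ h₂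
    have h2 : hT q r * hXinv q j = hXinv q j * hT q r := h1.units_inv_right
    simp only [map_mul, FreeAlgebra.lift_ι_apply, hashGen]
    rw [← hc, sub_mul, mul_sub, h2, cc]
  | T_X_T r =>
    simp only [map_mul, FreeAlgebra.lift_ι_apply, hashGen, AlgHom.commutes]
    exact T_X_T_aux (q - 1 : k) q _ _ _ _ _ (hT_quad q r) (hT_X_T q r) (hX_inv_mul q _)
      (hX_mul_inv q _)

/-- The involution `♯` of the affine Hecke algebra, an algebra homomorphism with
`T_r ↦ q - 1 - T_r = -q T_r⁻¹` and `X_j ↦ X_j⁻¹`. -/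
def hash : Hecke q m →ₐ[k] Hecke q m :=
  RingQuot.liftAlgHom k ⟨FreeAlgebra.lift k (hashGen q), fun _ _ h => hash_rel q h⟩

/-- The standard basis element `T_w` of the finite Hecke algebra, a product of generators along a
reduced expression of `w`. -/
def Tw (w : Equiv.Perm (Fin (m + 1))) : Hecke q m := ((reducedWord w).map (hT q)).prod

open Classical in
/-- The element `v_J^♯`, where `v_J = ∑_{w ∈ W_J} T_w`. -/
def vHash (J : Finset (Fin m)) : Hecke q m :=
  ∑ w ∈ Finset.univ.filter (fun w => w ∈ parabolic J), hash q (Tw q w)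

end

/-! ### The completed affine Hecke algebra -/

section

variable {k : Type*} [Field k] {q : kˣ} {m : ℕ} (i : Fin (m + 1) → Residue q)

variable (q) in
/-- The Laurent monomial `X₁^{α₁} ⋯ X_n^{α_n}` in the affine Hecke algebra. -/
def laurentMonomial (α : Fin (m + 1) → ℤ) : Hecke q m :=
  ((List.ofFn fun j => uX q j ^ α j).prod : (Hecke q m)ˣ)

/-- The kernel of the central character `X_j ↦ q ^ (i_j)` on the symmetric Laurent polynomials. -/
def centralKernel : Set (Hecke q m) :=
  {x | ∃ p : (Fin (m + 1) → ℤ) →₀ k,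
    (∀ (w : Equiv.Perm (Fin (m + 1))) (α : Fin (m + 1) → ℤ), p (α ∘ w) = p α) ∧
    (p.sum fun α c => c * ∏ j, (((q ^ (i j : ℤ)) ^ α j : kˣ) : k)) = 0 ∧
    x = p.sum fun α c => c • laurentMonomial q α}

/-- The two-sided ideal of the affine Hecke algebra generated by the kernel of the central
character. -/
def idealI : TwoSidedIdeal (Hecke q m) := TwoSidedIdeal.span (centralKernel i)

/-- The `r`-th power of the ideal `idealI i`. -/
def idealPow (r : ℕ) : TwoSidedIdeal (Hecke q m) :=
  TwoSidedIdeal.span {x | ∃ y : Fin r → Hecke q m, (∀ j, y j ∈ idealI i) ∧ x = (List.ofFn y).prod}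

/-- The quotient of the affine Hecke algebra by the `r`-th power of the ideal. -/
abbrev Quo (r : ℕ) : Type _ := (idealPow i r).ringCon.Quotient

/-- The quotient map. -/
abbrev toQuo (r : ℕ) : Hecke q m →ₐ[k] Quo i r := (idealPow i r).ringCon.mkₐ k

/-- The completed affine Hecke algebra: the inverse limit of the quotients by the powers of the
ideal, as the algebra of compatible families. -/
def hatSubalgebra : Subalgebra k (∀ r, Quo i r) where
  carrier := {x | ∀ r t, r ≤ t → ∃ h : Hecke q m, toQuo i r h = x r ∧ toQuo i t h = x t}
  mul_mem' := by
    intro x y hx hy r t hrt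
    obtain ⟨g, hg⟩ := hx r t hrt
    obtain ⟨h, hh⟩ := hy r t hrt
    exact ⟨g * h, by rw [map_mul, hg.1, hh.1]; rfl, by rw [map_mul, hg.2, hh.2]; rfl⟩
  add_mem' := by
    intro x y hx hy r t hrt
    obtain ⟨g, hg⟩ := hx r t hrt
    obtain ⟨h, hh⟩ := hy r t hrt
    exact ⟨g + h, by rw [map_add, hg.1, hh.1]; rfl, by rw [map_add, hg.2, hh.2]; rfl⟩
  algebraMap_mem' := fun c r t _ =>
    ⟨algebraMap k _ c, AlgHom.commutes _ c, AlgHom.commutes _ c⟩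

/-- The completed affine Hecke algebra. -/
abbrev HeckeHat : Type _ := hatSubalgebra i

/-- The canonical map from the affine Hecke algebra to its completion. -/
def toHat : Hecke q m →ₐ[k] HeckeHat i :=
  (AlgHom.pi fun r => toQuo i r).codRestrict (hatSubalgebra i)
    fun h _ _ _ => ⟨h, rfl, rfl⟩

/-- An element of the affine Hecke algebra which agrees with `x` modulo the `r`-th power of the
ideal. -/
def approx (r : ℕ) (x : HeckeHat i) : Hecke q m := (x.2 r r le_rfl).choose

theorem toQuo_approx (r : ℕ) (x : HeckeHat i) : toQuo i r (approx i r x) = x.1 r :=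
  (x.2 r r le_rfl).choose_spec.1

end

/-! ### Divided differences of power series -/

/-- The exponent `β` with the entries at `a` and `b` replaced by `p` and `q`. -/
def updTwo {σ : Type*} [DecidableEq σ] (a b : σ) (β : σ →₀ ℕ) (p q : ℕ) : σ →₀ ℕ :=
  (β.update a p).update b q

theorem coeff_rename_swap {σ k : Type*} [DecidableEq σ] [Finite σ] [Field k] (a b : σ) (hab : a ≠ b)
    (h : MvPowerSeries σ k) (β : σ →₀ ℕ) (p q : ℕ) :
    MvPowerSeries.coeff (updTwo a b β p q) (MvPowerSeries.rename (Equiv.swap a b) h) =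
      MvPowerSeries.coeff (updTwo a b β q p) h := by
  have h1 := MvPowerSeries.coeff_embDomain_rename (Equiv.swap a b).toEmbedding h
    (updTwo a b β q p)
  rw [← h1]
  congr 1
  congr 1
  ext x
  have h2 : x = (Equiv.swap a b).toEmbedding (Equiv.swap a b x) := by simp
  conv_rhs => rw [h2, Finsupp.embDomain_apply_self]
  unfold updTwo
  by_cases hb : x = b
  · subst hb; simp [Finsupp.update_apply, hab]
  · by_cases ha : x = a
    · subst ha; simp [hab, Function.update]
    · rw [Equiv.swap_apply_of_ne_of_ne ha hb]
      simp [ha, hb, Function.update]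

theorem exists_divDiff {σ k : Type*} [DecidableEq σ] [Finite σ] [Field k] (a b : σ) (hab : a ≠ b)
    (h : MvPowerSeries σ k) : ∃ g : MvPowerSeries σ k,
      (MvPowerSeries.X b - MvPowerSeries.X a) * g = h - MvPowerSeries.rename (Equiv.swap a b) h := by
  set G := h - MvPowerSeries.rename (Equiv.swap a b) h with hG
  let g : MvPowerSeries σ k := fun α =>
    ∑ j ∈ Finset.range (α a + 1), MvPowerSeries.coeff (updTwo a b α (α a - j) (α b + j + 1)) G
  have hg : ∀ α, MvPowerSeries.coeff α g = ∑ j ∈ Finset.range (α a + 1),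
    MvPowerSeries.coeff (updTwo a b α (α a - j) (α b + j + 1)) G := fun α => rfl
  refine ⟨g, ?_⟩
  ext β
  have hself : updTwo a b β (β a) (β b) = β := by simp [updTwo]
  have h1 : MvPowerSeries.coeff β (MvPowerSeries.X b * g) = if β b = 0 then 0 else
      ∑ j ∈ Finset.range (β a + 1), MvPowerSeries.coeff (updTwo a b β (β a - j) (β b + j)) G := by
    rw [MvPowerSeries.X, MvPowerSeries.coeff_monomial_mul]
    by_cases h0 : β b = 0
    · simp [h0, Finsupp.single_le_iff]
    · rw [if_pos (by rw [Finsupp.single_le_iff]; omega), if_neg h0, one_mul, hg]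
      have e1 : (β - Finsupp.single b 1 : σ →₀ ℕ) a = β a := by simp [hab]
      have e2 : (β - Finsupp.single b 1 : σ →₀ ℕ) b = β b - 1 := by simp
      rw [e1, e2]
      refine Finset.sum_congr rfl fun j _ => ?_
      congr 1
      congr 1
      rw [show β b - 1 + j + 1 = β b + j by omega]
      ext x
      by_cases hb : x = b
      · subst hb; simp [updTwo]
      · by_cases ha : x = a
        · subst ha; simp [updTwo, Function.update, hab]
        · simp [updTwo, Function.update, ha, hb]
  have h2 : MvPowerSeries.coeff β (MvPowerSeries.X a * g) =
      ∑ j ∈ Finset.range (β a), MvPowerSeries.coeff (updTwo a b β (β a - (j + 1)) (β b + (j + 1))) G := by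
    rw [MvPowerSeries.X, MvPowerSeries.coeff_monomial_mul]
    by_cases h0 : β a = 0
    · simp [h0, Finsupp.single_le_iff]
    · rw [if_pos (by rw [Finsupp.single_le_iff]; omega), one_mul, hg]
      have e1 : (β - Finsupp.single a 1 : σ →₀ ℕ) a = β a - 1 := by simp
      have e2 : (β - Finsupp.single a 1 : σ →₀ ℕ) b = β b := by simp [hab.symm]
      rw [e1, e2, show β a - 1 + 1 = β a by omega]
      refine Finset.sum_congr rfl fun j _ => ?_
      congr 1
      congr 1
      rw [show β a - 1 - j = β a - (j + 1) by omega]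
      ext x
      by_cases hb : x = b
      · subst hb; simp [updTwo]; omega
      · by_cases ha : x = a
        · subst ha; simp [updTwo, Function.update, hab]
        · simp [updTwo, Function.update, ha, hb]
  rw [sub_mul, map_sub, h1, h2]
  have h3 : ∑ j ∈ Finset.range (β a + 1), MvPowerSeries.coeff (updTwo a b β (β a - j) (β b + j)) G =
    ∑ j ∈ Finset.range (β a), MvPowerSeries.coeff (updTwo a b β (β a - (j + 1)) (β b + (j + 1))) G +
      MvPowerSeries.coeff β G := by
    rw [Finset.sum_range_succ', Nat.sub_zero, Nat.add_zero, hself]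
  by_cases h0 : β b = 0
  · have h4 : ∑ j ∈ Finset.range (β a + 1),
        MvPowerSeries.coeff (updTwo a b β (β a - j) (β b + j)) G = 0 := by
      rw [h0]
      simp only [hG, map_sub, coeff_rename_swap a b hab, zero_add, Finset.sum_sub_distrib]
      rw [sub_eq_zero, ← Finset.sum_range_reflect]
      refine Finset.sum_congr rfl fun j hj => ?_
      rw [Finset.mem_range] at hj
      congr 3
      all_goals omega
    rw [h4] at h3
    rw [if_pos h0, zero_sub]
    exact neg_eq_of_add_eq_zero_right h3.symm
  · rw [if_neg h0, h3]; ring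

/-! ### The completed polynomial representation -/

section

variable {k : Type*} [Field k] {q : kˣ} {m : ℕ}

/-- The ring of formal power series in `n = m + 1` variables. -/
abbrev PS (k : Type*) [Field k] (m : ℕ) : Type _ := MvPowerSeries (Fin (m + 1)) k

instance : IsDomain (PS k m) := NoZeroDivisors.to_isDomain _

/-- The field of fractions of the ring of formal power series. -/
abbrev PSFrac (k : Type*) [Field k] (m : ℕ) : Type _ := FractionRing (PS k m)

variable (k) in
/-- The ring automorphism of the power series ring permuting the variables by `w`. -/
def permPS (w : Equiv.Perm (Fin (m + 1))) : PS k m ≃+* PS k m :=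
  (MvPowerSeries.renameEquiv k w).toRingEquiv

variable (k) in
/-- The automorphism of the field of fractions permuting the variables by `w`. -/
def permFrac (w : Equiv.Perm (Fin (m + 1))) : PSFrac k m ≃+* PSFrac k m :=
  IsFractionRing.ringEquivOfRingEquiv (permPS k w)

theorem permPS_apply (w : Equiv.Perm (Fin (m + 1))) (f : PS k m) :
    permPS k w f = MvPowerSeries.rename w f := rfl

theorem permPS_mul (w v : Equiv.Perm (Fin (m + 1))) (f : PS k m) :
    permPS k w (permPS k v f) = permPS k (w * v) f := by
  simp only [permPS_apply, MvPowerSeries.rename_rename]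
  rfl

theorem permPS_one (f : PS k m) : permPS k 1 f = f := MvPowerSeries.rename_id_apply f

theorem permPS_X (w : Equiv.Perm (Fin (m + 1))) (j : Fin (m + 1)) :
    permPS k w (MvPowerSeries.X j) = MvPowerSeries.X (w j) := MvPowerSeries.rename_X ..

theorem permPS_C (w : Equiv.Perm (Fin (m + 1))) (c : k) :
    permPS k w (MvPowerSeries.C c) = MvPowerSeries.C c := MvPowerSeries.rename_C ..

theorem permFrac_algebraMap (w : Equiv.Perm (Fin (m + 1))) (f : PS k m) :
    permFrac k w (algebraMap _ _ f) = algebraMap _ _ (permPS k w f) :=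
  IsFractionRing.ringEquivOfRingEquiv_algebraMap _ _

theorem permFrac_mul (w v : Equiv.Perm (Fin (m + 1))) (f : PSFrac k m) :
    permFrac k w (permFrac k v f) = permFrac k (w * v) f := by
  obtain ⟨a, b, hb, rfl⟩ := IsFractionRing.div_surjective (A := PS k m) f
  simp only [map_div₀, permFrac_algebraMap, permPS_mul]

/-- The completed polynomial representation `⨁_u k⟦X₁, …, X_n⟧ e_u`, where `u` runs through the
orbit of `i`. The `j`-th power series variable in the component of `u` is the local coordinate
`X_j - q ^ (u_j)`. -/
abbrev PolyRep (i : Fin (m + 1) → Residue q) : Type _ := Orb i → PS k m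

/-- The componentwise field of fractions of the polynomial representation. -/
abbrev FracRep (i : Fin (m + 1) → Residue q) : Type _ := Orb i → PSFrac k m

variable {i : Fin (m + 1) → Residue q}

/-- The action of a permutation, `w (f e_u) = w(f) e_{w • u}`. -/
def perm (w : Equiv.Perm (Fin (m + 1))) : PolyRep i →+* PolyRep i :=
  RingHom.pi fun u => (permPS k w : PS k m →+* PS k m).comp (Pi.evalRingHom _ (w⁻¹ • u))

/-- The action of a permutation, `w (f e_u) = w(f) e_{w • u}`, on fractions. -/
def permF (w : Equiv.Perm (Fin (m + 1))) : FracRep i →+* FracRep i :=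
  RingHom.pi fun u => (permFrac k w : PSFrac k m →+* PSFrac k m).comp
    (Pi.evalRingHom _ (w⁻¹ • u))

/-- The embedding of the polynomial representation into its componentwise field of fractions. -/
def toFrac : PolyRep i →+* FracRep i :=
  RingHom.pi fun u => (algebraMap (PS k m) (PSFrac k m)).comp (Pi.evalRingHom _ u)

variable (i) in
/-- The element `X_j`: its component at `u` is `q ^ (u_j)` plus the local coordinate. -/
def Xel (j : Fin (m + 1)) : PolyRep i :=
  fun u => MvPowerSeries.C ((q ^ (u.1 j : ℤ) : kˣ) : k) + MvPowerSeries.X j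

variable (i) in
/-- The element `X_j⁻¹`. -/
def Xinvel (j : Fin (m + 1)) : PolyRep i := fun u => (Xel i j u)⁻¹

theorem perm_apply (w : Equiv.Perm (Fin (m + 1))) (f : PolyRep i) (u : Orb i) :
    perm w f u = permPS k w (f (w⁻¹ • u)) := rfl

theorem permF_apply (w : Equiv.Perm (Fin (m + 1))) (f : FracRep i) (u : Orb i) :
    permF w f u = permFrac k w (f (w⁻¹ • u)) := rfl

theorem toFrac_apply (f : PolyRep i) (u : Orb i) : toFrac f u = algebraMap _ _ (f u) := rfl

theorem toFrac_injective : Function.Injective (toFrac (i := i)) := by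
  intro f g h
  funext u
  exact IsFractionRing.injective (PS k m) (PSFrac k m) (congrFun h u)

theorem permF_toFrac (w : Equiv.Perm (Fin (m + 1))) (f : PolyRep i) :
    permF w (toFrac f) = toFrac (perm w f) := by
  funext u
  exact permFrac_algebraMap _ _

theorem permF_permF (w v : Equiv.Perm (Fin (m + 1))) (f : FracRep i) :
    permF w (permF v f) = permF (w * v) f := by
  funext u
  simp only [permF_apply, permFrac_mul, mul_inv_rev, mul_smul]

theorem perm_Xel (w : Equiv.Perm (Fin (m + 1))) (j : Fin (m + 1)) :
    perm w (Xel i j) = Xel i (w j) := by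
  funext u
  simp only [perm_apply, Xel, map_add, permPS_C, permPS_X, smul_apply, inv_inv]

theorem Xel_mul_inv (j : Fin (m + 1)) : Xel i j * Xinvel i j = 1 := by
  funext u
  refine MvPowerSeries.mul_inv_cancel _ ?_
  rw [Xel, map_add, MvPowerSeries.constantCoeff_C, MvPowerSeries.constantCoeff_X, add_zero]
  exact Units.ne_zero _

theorem Xel_sub_ne (j l : Fin (m + 1)) (h : j ≠ l) (u : Orb i) : Xel i l u - Xel i j u ≠ 0 := by
  classical
  intro h0
  have h1 := congrArg (MvPowerSeries.coeff (Finsupp.single l 1)) h0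
  simp [Xel, MvPowerSeries.coeff_C, MvPowerSeries.coeff_X, Finsupp.single_left_inj, h.symm] at h1

theorem s_inv (r : Fin m) : (s r)⁻¹ = s r := Equiv.swap_inv _ _

theorem castSucc_ne_succ (r : Fin m) : r.castSucc ≠ r.succ :=
  (Fin.castSucc_lt_succ (i := r)).ne

theorem exists_dividedDifference (r : Fin m) (f : PolyRep i) :
    ∃ g : PolyRep i, (Xel i r.succ - Xel i r.castSucc) * g = f - perm (s r) f := by
  have key : ∀ u : Orb i, ∃ g : PS k m,
      (Xel i r.succ u - Xel i r.castSucc u) * g = f u - perm (s r) f u := by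
    intro u
    by_cases hu : u.1 r.castSucc = u.1 r.succ
    · obtain ⟨g, hg⟩ := exists_divDiff r.castSucc r.succ (castSucc_ne_succ r) (f u)
      refine ⟨g, ?_⟩
      have h1 : (s r)⁻¹ • u = u := by
        apply Subtype.ext
        funext j
        rw [smul_apply, inv_inv]
        unfold s
        rcases eq_or_ne j r.castSucc with rfl | h1
        · rw [Equiv.swap_apply_left, hu]
        · rcases eq_or_ne j r.succ with rfl | h2
          · rw [Equiv.swap_apply_right, hu]
          · rw [Equiv.swap_apply_of_ne_of_ne h1 h2]
      rw [perm_apply, h1]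
      simp only [Xel, hu, add_sub_add_left_eq_sub]
      exact hg
    · have h1 : MvPowerSeries.constantCoeff (Xel i r.succ u - Xel i r.castSucc u) ≠ 0 := by
        simp only [Xel, map_sub, map_add, MvPowerSeries.constantCoeff_C,
          MvPowerSeries.constantCoeff_X, add_zero]
        rw [sub_ne_zero]
        intro h2
        exact hu (Residue.zpow_injective q (Units.ext h2.symm))
      refine ⟨(Xel i r.succ u - Xel i r.castSucc u)⁻¹ * (f u - perm (s r) f u), ?_⟩
      rw [← mul_assoc, MvPowerSeries.mul_inv_cancel _ h1, one_mul]
  choose g hg using key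
  exact ⟨g, funext hg⟩

/-- The divided difference `(f - s_r f) / (X_{r+1} - X_r)`. -/
def divDiff (r : Fin m) (f : PolyRep i) : PolyRep i := (exists_dividedDifference r f).choose

theorem divDiff_spec (r : Fin m) (f : PolyRep i) :
    (Xel i r.succ - Xel i r.castSucc) * divDiff r f = f - perm (s r) f :=
  (exists_dividedDifference r f).choose_spec

theorem perm_smul (w : Equiv.Perm (Fin (m + 1))) (c : k) (f : PolyRep i) :
    perm w (c • f) = c • perm w f := by
  funext u
  simp only [perm_apply, Pi.smul_apply, permPS_apply, map_smul]

/-- The operator `T_r`, determined by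
`(T_r + 1) f = (q X_{r+1} - X_r) / (X_{r+1} - X_r) * (f - s_r f)`. -/
def opT (r : Fin m) : Module.End k (PolyRep i) where
  toFun f := (algebraMap k _ (q : k) * Xel i r.succ - Xel i r.castSucc) * divDiff r f - f
  map_add' f g := by
    have h : divDiff r (f + g) = divDiff r f + divDiff r g := by
      funext u
      refine mul_left_cancel₀ (Xel_sub_ne (i := i) _ _ (castSucc_ne_succ r) u) ?_
      have h1 := congrFun (divDiff_spec r (f + g)) u
      have h2 := congrFun (divDiff_spec r f) u
      have h3 := congrFun (divDiff_spec r g) u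
      rw [map_add] at h1
      simp only [Pi.mul_apply, Pi.sub_apply, Pi.add_apply] at h1 h2 h3 ⊢
      rw [h1, mul_add, h2, h3]; ring
    rw [h]; ring
  map_smul' c f := by
    have h : divDiff r (c • f) = c • divDiff r f := by
      funext u
      refine mul_left_cancel₀ (Xel_sub_ne (i := i) _ _ (castSucc_ne_succ r) u) ?_
      have h1 := congrFun (divDiff_spec r (c • f)) u
      have h2 := congrFun (divDiff_spec r f) u
      rw [perm_smul] at h1
      simp only [Pi.mul_apply, Pi.sub_apply, Pi.smul_apply] at h1 h2 ⊢
      rw [h1, mul_smul_comm, h2, smul_sub]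
    rw [h, mul_smul_comm, RingHom.id_apply, smul_sub]

/-- The operators by which the generators of the affine Hecke algebra act. -/
def opGen : Gen m → Module.End k (PolyRep i)
  | Gen.T r => opT r
  | Gen.X j => LinearMap.mulLeft k (Xel i j)
  | Gen.Xinv j => LinearMap.mulLeft k (Xinvel i j)

/-- The rational function `X_j` as an element of the componentwise field of fractions. -/
abbrev XF (i : Fin (m + 1) → Residue q) (j : Fin (m + 1)) : FracRep i := toFrac (Xel i j)

/-- The constant `q` as an element of the componentwise field of fractions. -/
abbrev qF (i : Fin (m + 1) → Residue q) : FracRep i :=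
  toFrac (algebraMap k (PolyRep i) (q : k))

theorem permF_XF (w : Equiv.Perm (Fin (m + 1))) (j : Fin (m + 1)) :
    permF w (XF i j) = XF i (w j) := by
  rw [XF, permF_toFrac, perm_Xel]

theorem permF_qF (w : Equiv.Perm (Fin (m + 1))) : permF w (qF i) = qF i := by
  rw [qF, permF_toFrac]
  congr 1
  funext u
  exact permPS_C w _

theorem XF_sub_ne (j l : Fin (m + 1)) (h : j ≠ l) (u : Orb i) : XF i l u - XF i j u ≠ 0 := by
  intro h0
  change algebraMap (PS k m) (PSFrac k m) (Xel i l u) - algebraMap _ _ (Xel i j u) = 0 at h0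
  rw [← map_sub] at h0
  apply Xel_sub_ne j l h u
  exact IsFractionRing.injective (PS k m) (PSFrac k m) (by rw [h0, map_zero])

theorem toFrac_opT (r : Fin m) (f : PolyRep i) : toFrac (opT r f) =
    (qF i * XF i r.succ - XF i r.castSucc) / (XF i r.succ - XF i r.castSucc) *
      (toFrac f - permF (s r) (toFrac f)) - toFrac f := by
  have h := congrArg toFrac (divDiff_spec r f)
  rw [map_mul, map_sub, map_sub] at h
  rw [permF_toFrac, ← h]
  change toFrac ((algebraMap k _ (q : k) * Xel i r.succ - Xel i r.castSucc) * divDiff r f - f) = _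
  rw [map_sub, map_mul, map_sub, map_mul]
  congr 1
  funext u
  have h0 := XF_sub_ne (i := i) _ _ (castSucc_ne_succ r) u
  simp only [Pi.mul_apply, Pi.sub_apply, Pi.div_apply]
  field_simp

theorem permF_div (w : Equiv.Perm (Fin (m + 1))) (f g : FracRep i) :
    permF w (f / g) = permF w f / permF w g := by
  funext u
  simp only [permF_apply, Pi.div_apply, map_div₀]

/-- The operator `T_r` on fractions. -/
def TF (r : Fin m) (f : FracRep i) : FracRep i :=
  (qF i * XF i r.succ - XF i r.castSucc) / (XF i r.succ - XF i r.castSucc) *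
    (f - permF (s r) f) - f

theorem s_castSucc (r : Fin m) : s r r.castSucc = r.succ := Equiv.swap_apply_left _ _

theorem s_succ (r : Fin m) : s r r.succ = r.castSucc := Equiv.swap_apply_right _ _

theorem s_of_ne (r : Fin m) (j : Fin (m + 1)) (h₁ : j ≠ r.castSucc) (h₂ : j ≠ r.succ) :
    s r j = j := Equiv.swap_apply_of_ne_of_ne h₁ h₂

theorem s_mul_self (r : Fin m) : s r * s r = 1 := Equiv.swap_mul_self _ _

theorem permF_s_s (r : Fin m) (f : FracRep i) : permF (s r) (permF (s r) f) = f := by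
  rw [permF_permF, s_mul_self]
  funext u
  rw [permF_apply, inv_one, one_smul]
  obtain ⟨a, b, hb, h⟩ := IsFractionRing.div_surjective (A := PS k m) (f u)
  rw [← h, map_div₀, permFrac_algebraMap, permFrac_algebraMap]
  rw [permPS_one, permPS_one]

theorem TF_quad (r : Fin m) (f : FracRep i) :
    TF r (TF r f + f) - qF i * (TF r f + f) = 0 := by
  simp only [TF, map_sub, map_add, map_mul, permF_div, permF_XF, permF_qF, permF_s_s, s_castSucc,
    s_succ]
  funext u
  have h1 := XF_sub_ne (i := i) _ _ (castSucc_ne_succ r) u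
  have h2 := XF_sub_ne (i := i) _ _ (castSucc_ne_succ r).symm u
  simp only [Pi.mul_apply, Pi.sub_apply, Pi.div_apply, Pi.add_apply, Pi.zero_apply]
  generalize XF i r.succ u = y at *
  generalize XF i r.castSucc u = x at *
  have h3 : x - y = - (y - x) := by ring
  rw [h3]
  field_simp
  ring

theorem TF_T_X (r : Fin m) (j : Fin (m + 1)) (h₁ : j ≠ r.castSucc) (h₂ : j ≠ r.succ)
    (f : FracRep i) : TF r (XF i j * f) = XF i j * TF r f := by
  simp only [TF, map_mul, permF_XF, s_of_ne r j h₁ h₂]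
  ring

theorem TF_T_X_T (r : Fin m) (f : FracRep i) :
    TF r (XF i r.castSucc * TF r f) = qF i * (XF i r.succ * f) := by
  simp only [TF, map_sub, map_mul, permF_div, permF_XF, permF_qF, permF_s_s, s_castSucc,
    s_succ]
  funext u
  have h1 := XF_sub_ne (i := i) _ _ (castSucc_ne_succ r) u
  have h2 := XF_sub_ne (i := i) _ _ (castSucc_ne_succ r).symm u
  simp only [Pi.mul_apply, Pi.sub_apply, Pi.div_apply]
  generalize XF i r.succ u = y at *
  generalize XF i r.castSucc u = x at *
  have h3 : x - y = - (y - x) := by ring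
  rw [h3]
  field_simp
  ring

theorem TF_comm (r t : Fin m) (h : (r : ℕ) + 1 < t) (f : FracRep i) :
    TF r (TF t f) = TF t (TF r f) := by
  have a1 : s r t.castSucc = t.castSucc :=
    s_of_ne _ _ (by simp [Fin.ext_iff]; omega) (by simp [Fin.ext_iff]; omega)
  have a2 : s r t.succ = t.succ :=
    s_of_ne _ _ (by simp [Fin.ext_iff]; omega) (by simp [Fin.ext_iff]; omega)
  have a3 : s t r.castSucc = r.castSucc :=
    s_of_ne _ _ (by simp [Fin.ext_iff]; omega) (by simp [Fin.ext_iff]; omega)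
  have a4 : s t r.succ = r.succ :=
    s_of_ne _ _ (by simp [Fin.ext_iff]; omega) (by simp [Fin.ext_iff]; omega)
  have hs : s r * s t = s t * s r := by
    have := Equiv.mul_swap_eq_swap_mul (s r) t.castSucc t.succ
    rw [a1, a2] at this
    exact this
  have hp : permF (s r) (permF (s t) f) = permF (s t) (permF (s r) f) := by
    rw [permF_permF, permF_permF, hs]
  simp only [TF, map_sub, map_mul, permF_div, permF_XF, permF_qF, a1, a2, a3, a4, hp]
  ring

theorem TF_braid (r t : Fin m) (h : (r : ℕ) + 1 = t) (f : FracRep i) :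
    TF r (TF t (TF r f)) = TF t (TF r (TF t f)) := by
  have e : t.castSucc = r.succ := by simp [Fin.ext_iff]; omega
  have a2 : s r t.succ = t.succ :=
    s_of_ne _ _ (by simp [Fin.ext_iff]; omega) (by simp [Fin.ext_iff]; omega)
  have a3 : s t r.castSucc = r.castSucc :=
    s_of_ne _ _ (by simp [Fin.ext_iff]; omega) (by simp [Fin.ext_iff]; omega)
  have a4 : s t r.succ = t.succ := by rw [← e]; exact s_castSucc t
  have a5 : s t t.succ = r.succ := by rw [← e]; exact s_succ t
  have hs : s t * s r * s t = s r * s t * s r := by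
    have h1 := Equiv.mul_swap_eq_swap_mul (s t * s r) t.castSucc t.succ
    have b1 : (s t * s r) t.castSucc = r.castSucc := by
      rw [Equiv.Perm.mul_apply, e, s_succ, a3]
    have b2 : (s t * s r) t.succ = r.succ := by
      rw [Equiv.Perm.mul_apply, a2, a5]
    rw [b1, b2] at h1
    change s t * s r * s t = s r * (s t * s r) at h1
    rw [h1, mul_assoc]
  have hp : permF (s t) (permF (s r) (permF (s t) f)) =
      permF (s r) (permF (s t) (permF (s r) f)) := by
    simp only [permF_permF, ← mul_assoc, hs]
  have n1 : r.castSucc ≠ t.succ := by simp [Fin.ext_iff]; omega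
  have n2 : r.succ ≠ t.succ := by rw [← e]; exact castSucc_ne_succ t
  simp only [TF, map_sub, map_mul, permF_div, permF_XF, permF_qF, permF_s_s, e, s_castSucc,
    s_succ, a2, a3, a4, a5, hp]
  funext u
  have h1 := XF_sub_ne (i := i) _ _ (castSucc_ne_succ r) u
  have h2 := XF_sub_ne (i := i) _ _ n1 u
  have h3 := XF_sub_ne (i := i) _ _ n2 u
  simp only [Pi.mul_apply, Pi.sub_apply, Pi.div_apply]
  generalize XF i r.succ u = y at *
  generalize XF i r.castSucc u = x at *
  generalize XF i t.succ u = z at *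
  rw [← neg_sub y x, ← neg_sub z y]
  field_simp
  ring

theorem toFrac_opT' (r : Fin m) (f : PolyRep i) : toFrac (opT r f) = TF r (toFrac f) :=
  toFrac_opT r f

theorem toFrac_algebraMap_mul (f : PolyRep i) :
    toFrac ((q : k) • f) = qF i * toFrac f := by
  rw [Algebra.smul_def, map_mul]

theorem op_rel {x y : FreeAlgebra k (Gen m)} (h : Rel q m x y) :
    FreeAlgebra.lift k (opGen (i := i)) x = FreeAlgebra.lift k (opGen (i := i)) y := by
  apply LinearMap.ext
  intro f
  cases h with
  | quad r =>
    apply toFrac_injective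
    simp only [map_mul, map_sub, map_add, map_one, map_zero, FreeAlgebra.lift_ι_apply, opGen,
      AlgHom.commutes, Module.End.mul_apply, LinearMap.sub_apply, LinearMap.add_apply,
      Module.End.one_apply, Module.algebraMap_end_apply, LinearMap.zero_apply]
    have h := TF_quad r (toFrac f)
    rw [← toFrac_opT', ← map_add, ← toFrac_opT', ← toFrac_algebraMap_mul, ← map_sub] at h
    rw [map_add (opT r), smul_add, map_sub, map_add, map_add] at h
    rw [← h]
    ring
  | comm r t h =>
    apply toFrac_injective
    simp only [map_mul, FreeAlgebra.lift_ι_apply, opGen, Module.End.mul_apply, toFrac_opT',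
      TF_comm r t h]
  | braid r t h =>
    apply toFrac_injective
    simp only [map_mul, FreeAlgebra.lift_ι_apply, opGen, Module.End.mul_apply, toFrac_opT',
      TF_braid r t h]
  | X_mul_inv j =>
    simp only [map_mul, map_one, FreeAlgebra.lift_ι_apply, opGen, Module.End.mul_apply,
      LinearMap.mulLeft_apply, Module.End.one_apply]
    rw [← mul_assoc, Xel_mul_inv, one_mul]
  | inv_mul_X j =>
    simp only [map_mul, map_one, FreeAlgebra.lift_ι_apply, opGen, Module.End.mul_apply,
      LinearMap.mulLeft_apply, Module.End.one_apply]
    rw [← mul_assoc, mul_comm (Xinvel i j), Xel_mul_inv, one_mul]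
  | X_comm j l =>
    simp only [map_mul, FreeAlgebra.lift_ι_apply, opGen, Module.End.mul_apply,
      LinearMap.mulLeft_apply]
    ring
  | T_X r j h₁ h₂ =>
    apply toFrac_injective
    simp only [map_mul, FreeAlgebra.lift_ι_apply, opGen, Module.End.mul_apply, toFrac_opT',
      LinearMap.mulLeft_apply]
    exact TF_T_X r j h₁ h₂ _
  | T_X_T r =>
    apply toFrac_injective
    simp only [map_mul, FreeAlgebra.lift_ι_apply, opGen, Module.End.mul_apply, toFrac_opT',
      LinearMap.mulLeft_apply, AlgHom.commutes, Module.algebraMap_end_apply, toFrac_algebraMap_mul]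
    exact TF_T_X_T r _

variable (i) in
/-- The polynomial representation of the affine Hecke algebra on `⨁_u k⟦X₁, …, X_n⟧ e_u`. -/
def heckeRep : Hecke q m →ₐ[k] Module.End k (PolyRep i) :=
  RingQuot.liftAlgHom k ⟨FreeAlgebra.lift k opGen, fun _ _ h => op_rel h⟩

variable (i) in
/-- The action of the completed affine Hecke algebra on the polynomial representation. The
`r`-th power of the ideal maps into the series of order at least `r`, so the coefficients of degree
less than `r` are computed modulo the `r`-th power of the ideal. -/
def hatAct (x : HeckeHat i) (f : PolyRep i) : PolyRep i :=
  fun u α => MvPowerSeries.coeff α (heckeRep i (approx i (α.degree + 1) x) f u)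

end

/-! ### The twisted completed faithful representation -/

section

variable {k : Type*} [Field k] {q : kˣ} {m : ℕ} {i : Fin (m + 1) → Residue q}

open Classical in
/-- The map `g ↦ ∑_w w(g) e_{w • u}`, where `w` runs through the minimal length representatives of
the cosets in `W_J` of the stabiliser of `u`. -/
def xi (J : Finset (Fin m)) (u : Orb i) (g : PS k m) : PolyRep i :=
  ∑ w ∈ cosetReps J (stab J u), Pi.single (w • u) (permPS k w g)

/-- The space `R̂_{+,u}` for `u ∈ U J`: the image under `xi J u` of the power series
invariant under the stabiliser of `u` in `W_J`. -/
def Rhat (J : Finset (Fin m)) (u : Orb i) : Set (PolyRep i) :=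
  {f | ∃ g : PS k m, (∀ w ∈ parabolic (stab J u), permPS k w g = g) ∧ f = xi J u g}

variable (i) in
/-- The space `⨁_J ⨁_{u ∈ U J} R̂_{+,u} v̄^{(J)}`, as a subspace of `⨁_J PolyRep v̄^{(J)}`. -/
def twistedRep : Submodule k (Finset (Fin m) → PolyRep i) :=
  Submodule.pi Set.univ fun J => Submodule.span k (⋃ u ∈ (U J : Set (Orb i)), Rhat J u)

variable (i) in
/-- The right ideal generated by `v_J^♯` in the completed affine Hecke algebra. -/
def vIdeal (J : Finset (Fin m)) : Submodule (HeckeHat i)ᵐᵒᵖ (HeckeHat i) :=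
  Submodule.span (HeckeHat i)ᵐᵒᵖ {toHat i (vHash q J)}

variable (i) in
/-- The generator `v_J^♯` of `vIdeal i J`. -/
def vGen (J : Finset (Fin m)) : vIdeal i J :=
  ⟨toHat i (vHash q J), Submodule.mem_span_singleton_self _⟩

variable (i) in
/-- The completed affine Schur algebra in its twisted form: the endomorphisms of the right module
`⨁_J v_J^♯ Ĥ` over the completed affine Hecke algebra `Ĥ`. -/
abbrev SchurHat : Type _ :=
  Module.End (HeckeHat i)ᵐᵒᵖ (∀ J : Finset (Fin m), vIdeal i J)

open Classical in
/-- An element `h` of the completed affine Hecke algebra such that the component of `φ` from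
`v_J^♯ Ĥ` to `v_K^♯ Ĥ` sends `v_J^♯` to `h v_J^♯`. -/
def coeffHat (φ : SchurHat i) (K J : Finset (Fin m)) : HeckeHat i :=
  if h : ∃ x : HeckeHat i, (φ (Pi.single J (vGen i J)) K : HeckeHat i) = x * toHat i (vHash q J)
  then h.choose else 0

/-- The action of the completed affine Schur algebra: if `φ` sends `v_J^♯` to `∑_K h_K v_J^♯` then
`φ (f v̄^{(J)}) = ∑_K (h_K f) v̄^{(K)}`. -/
def rho (φ : SchurHat i) (F : Finset (Fin m) → PolyRep i) : Finset (Fin m) → PolyRep i :=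
  fun K => ∑ J, hatAct i (coeffHat φ K J) (F J)

open Classical in
/-- The characterisation of the basis element `b^1_{K,J}` of the Schur algebra: it sends `v_J^♯` to
`∑_{w ∈ W_K W_J} T_w^♯`, placed in the summand of `K`, and vanishes on all other summands. -/
def IsBasisOne (K J : Finset (Fin m)) (φ : SchurHat i) : Prop :=
  (∀ L, (φ (Pi.single J (vGen i J)) L : HeckeHat i) =
    if L = K then toHat i (∑ w ∈ doubleCosetOne K J, hash q (Tw q w)) else 0) ∧
  ∀ J', J' ≠ J → ∀ x : vIdeal i J', φ (Pi.single J' x) = 0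

variable (i) in
/-- The rational function `θ_{j,l} = (q X_j - X_l) / (X_j - X_l)`. -/
def theta (j l : Fin (m + 1)) : FracRep i := (qF i * XF i j - XF i l) / (XF i j - XF i l)

/-- The symmetrising operator `⋔^t_{t'}`: the sum over the minimal length representatives of the
cosets of the Young subgroup of type `t'` in the Young subgroup of type `t`. -/
def symmetrise (t t' : List ℕ) (f : FracRep i) : FracRep i :=
  ∑ w ∈ cosetReps (ofType (m := m) t) (ofType t'), permF w f

variable (i) in
/-- The distinct entries of the residue sequence `i`, in increasing order. -/
def entries : List (Residue q) := (Finset.univ.image i).sort (· ≤ ·)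

/-- The multiplicities `d_c` of the entries `c` in `u`. -/
def multiplicities (u : Orb i) : List ℕ :=
  (entries i).map fun c => (Finset.univ.filter fun j => u.1 j = c).card

/-- The sequence `a₁, b₁, a₂, b₂, …` of the multiplicities of the entries in the first block (the
positions up to `a`) and in the second block (the positions after `a`) of `u`. -/
def splitMultiplicities (a : Fin m) (u : Orb i) : List ℕ :=
  (entries i).flatMap fun c =>
    [(Finset.univ.filter fun j => j ≤ a.castSucc ∧ u.1 j = c).card,
      (Finset.univ.filter fun j => a.castSucc < j ∧ u.1 j = c).card]

end

end
end AffineSchur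

open AffineSchur

/-!
Let `J` be the set of simple reflections that preserve the two blocks `{1, …, a}` and
`{a + 1, …, n}`, and let `K` be the set of all simple reflections. Since `v_K^♯` is
`(∑ T_d^♯) v_J^♯` with `d` running through the minimal representatives of `W_K / W_J`, the map
`b^1_{K,J}` is left multiplication by `∑ T_d^♯`.

In the skew group algebra of `W` over the fractions, `v_J^♯` acts as multiplication by the product
of the `θ_{j,l}` over all pairs `j < l` in a common block, followed by symmetrisation over `W_J`.
Indeed the image of `v_J^♯` consists of `W_J`-invariants, so its coefficients are determined by the
one at the longest element of `W_J`, which comes from a single `T_w^♯`.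

Over the fractions every `W_J`-invariant is in the image of `v_J^♯`, so one can compare the two
symmetrisers: only the `θ_{j,l}` with `j ≤ a < l` and the sum over the coset representatives of
`W_K / W_J` remain. At the idempotent of the sorted sequence `u_K` a coset contributes only if it
contains an element that maps `u_J` to `u_K`, and minimality of `σ` identifies these cosets with
those of the refined Young subgroup in the stabiliser of `u_K`.
-/

namespace AffineSchur

noncomputable section

/-! ### Inversions and the length function -/

section Length

variable {m : ℕ} {w : Equiv.Perm (Fin (m + 1))} {r : Fin m}

theorem s_s_apply (r : Fin m) (j : Fin (m + 1)) : s r (s r j) = j := Equiv.swap_apply_self _ _ _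

theorem s_symm (r : Fin m) : (s r).symm = s r := Equiv.symm_swap _ _

theorem mul_s_mul_s (w : Equiv.Perm (Fin (m + 1))) (r : Fin m) : w * s r * s r = w :=
  Equiv.mul_swap_mul_self _ _ w

theorem s_mul_s_mul (w : Equiv.Perm (Fin (m + 1))) (r : Fin m) : s r * (s r * w) = w :=
  Equiv.swap_mul_self_mul _ _ w

theorem apply_s_of_eq {β : Type*} {φ : Fin (m + 1) → β} (h : φ r.castSucc = φ r.succ)
    (j : Fin (m + 1)) : φ (s r j) = φ j := by
  rw [s, Equiv.swap_apply_def]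
  split_ifs with h₁ h₂
  · rw [h₁, h]
  · rw [h₂, h]
  · rfl

theorem s_lt_s {a b : Fin (m + 1)} (hab : a < b) (h : (a, b) ≠ (r.castSucc, r.succ)) :
    s r a < s r b := by
  rw [s, Equiv.swap_apply_def, Equiv.swap_apply_def]
  rw [Ne, Prod.mk.injEq, Fin.ext_iff, Fin.ext_iff, Fin.val_castSucc, Fin.val_succ] at h
  rw [Fin.lt_def] at hab ⊢
  split_ifs <;> simp only [Fin.ext_iff, Fin.val_castSucc, Fin.val_succ] at * <;> omega

theorem apply_castSucc_lt_or_gt (w : Equiv.Perm (Fin (m + 1))) (r : Fin m) :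
    w r.castSucc < w r.succ ∨ w r.succ < w r.castSucc :=
  lt_or_gt_of_ne <| w.injective.ne (castSucc_ne_succ r)

/-- The inversions of `w`: the pairs of positions whose order is reversed by `w`. -/
def inversions (w : Equiv.Perm (Fin (m + 1))) : Finset (Fin (m + 1) × Fin (m + 1)) :=
  {p | p.1 < p.2 ∧ w p.2 < w p.1}

theorem mem_inversions {p : Fin (m + 1) × Fin (m + 1)} :
    p ∈ inversions w ↔ p.1 < p.2 ∧ w p.2 < w p.1 :=
  Finset.mem_filter_univ p

theorem inversions_one : inversions (1 : Equiv.Perm (Fin (m + 1))) = ∅ :=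
  Finset.filter_eq_empty_iff.2 fun _ _ h => lt_asymm h.1 h.2

theorem inversions_mul_s (h : w r.castSucc < w r.succ) :
    inversions (w * s r) = insert (r.castSucc, r.succ)
      ((inversions w).map ((s r).prodCongr (s r)).toEmbedding) := by
  ext ⟨a, b⟩
  rw [Finset.mem_insert, Finset.mem_map_equiv, mem_inversions, mem_inversions]
  simp only [Equiv.prodCongr_symm, Equiv.prodCongr_apply, Prod.map, s_symm,
    Equiv.Perm.mul_apply]
  by_cases hab : (a, b) = (r.castSucc, r.succ)
  · obtain ⟨rfl, rfl⟩ := Prod.mk.inj hab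
    simp [s_castSucc, s_succ, h]
  · have hab' (hw : w (s r b) < w (s r a)) : (s r a, s r b) ≠ (r.castSucc, r.succ) := by
      rintro heq
      obtain ⟨ha, hb⟩ := Prod.mk.inj heq
      exact lt_asymm h (by rwa [ha, hb] at hw)
    rw [or_iff_right hab]
    refine and_congr_left fun hw => ⟨(s_lt_s · hab), fun h' => ?_⟩
    simpa only [s_s_apply] using s_lt_s h' (hab' hw)

theorem castSucc_succ_notMem_map_inversions :
    (r.castSucc, r.succ) ∉ (inversions w).map ((s r).prodCongr (s r)).toEmbedding := by
  rw [Finset.mem_map_equiv, mem_inversions]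
  simp [s_symm, s_castSucc, s_succ, Fin.castSucc_lt_succ.le]

theorem prod_inversions_mul_s {M : Type*} [CommMonoid M] (h : w r.castSucc < w r.succ)
    (f : Fin (m + 1) × Fin (m + 1) → M) :
    ∏ p ∈ inversions (w * s r), f p =
      f (r.castSucc, r.succ) * ∏ p ∈ inversions w, f (s r p.1, s r p.2) := by
  rw [inversions_mul_s h, Finset.prod_insert castSucc_succ_notMem_map_inversions, Finset.prod_map]
  rfl

theorem card_inversions_mul_s_of_lt (h : w r.castSucc < w r.succ) :
    (inversions (w * s r)).card = (inversions w).card + 1 := by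
  rw [inversions_mul_s h, Finset.card_insert_of_notMem castSucc_succ_notMem_map_inversions,
    Finset.card_map]

theorem card_inversions_mul_s_of_gt (h : w r.succ < w r.castSucc) :
    (inversions (w * s r)).card + 1 = (inversions w).card := by
  rw [← card_inversions_mul_s_of_lt (w := w * s r) (r := r), mul_s_mul_s]
  simpa [s_castSucc, s_succ] using h

theorem eq_one_of_ascents (h : ∀ r : Fin m, w r.castSucc < w r.succ) : w = 1 :=
  Equiv.coe_fn_injective (Fin.strictMono_iff_lt_succ.2 h).eq_id

theorem exists_descent_of_ne_one {α : Type*} [PartialOrder α] {φ : Fin (m + 1) → α}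
    (hφ : Monotone φ) (hw : ∀ j, φ (w j) = φ j) (hne : w ≠ 1) :
    ∃ r : Fin m, φ r.castSucc = φ r.succ ∧ w r.succ < w r.castSucc := by
  obtain ⟨r, hr⟩ := not_forall.1 fun h => hne (eq_one_of_ascents h)
  have hr' := (apply_castSucc_lt_or_gt w r).resolve_left hr
  refine ⟨r, le_antisymm (hφ Fin.castSucc_lt_succ.le) ?_, hr'⟩
  rw [← hw r.succ, ← hw r.castSucc]
  exact hφ hr'.le

@[elab_as_elim]
theorem stabilizer_induction {α : Type*} [PartialOrder α] {φ : Fin (m + 1) → α}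
    (hφ : Monotone φ) {P : Equiv.Perm (Fin (m + 1)) → Prop} (one : P 1)
    (mul_s : ∀ (w : Equiv.Perm (Fin (m + 1))) (r : Fin m), (∀ j, φ (w j) = φ j) →
      φ r.castSucc = φ r.succ → w r.castSucc < w r.succ → P w → P (w * s r))
    (w : Equiv.Perm (Fin (m + 1))) (hw : ∀ j, φ (w j) = φ j) : P w := by
  induction hn : (inversions w).card using Nat.strong_induction_on generalizing w with
  | _ n ih =>
    rcases eq_or_ne w 1 with rfl | hne
    · exact one
    obtain ⟨r, hφr, hr⟩ := exists_descent_of_ne_one hφ hw hne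
    have hws (j) : φ ((w * s r) j) = φ j := (hw _).trans (apply_s_of_eq hφr j)
    have hcard := card_inversions_mul_s_of_gt hr
    rw [← mul_s_mul_s w r]
    exact mul_s _ r hws hφr (by simpa [s_castSucc, s_succ] using hr) (ih _ (by omega) _ hws rfl)

@[elab_as_elim]
theorem perm_induction {P : Equiv.Perm (Fin (m + 1)) → Prop} (one : P 1)
    (mul_s : ∀ (w : Equiv.Perm (Fin (m + 1))) (r : Fin m),
      w r.castSucc < w r.succ → P w → P (w * s r)) (w : Equiv.Perm (Fin (m + 1))) : P w :=
  stabilizer_induction (φ := fun _ => ()) monotone_const one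
    (fun w r _ _ h => mul_s w r h) w fun _ => rfl

theorem len_prod_le (l : List (Fin m)) : len (l.map s).prod ≤ l.length :=
  Nat.sInf_le ⟨l, rfl, rfl⟩

theorem card_inversions_prod_le (l : List (Fin m)) :
    (inversions (l.map s).prod).card ≤ l.length := by
  induction l using List.reverseRecOn with
  | nil => simp [inversions_one]
  | append_singleton l r ih =>
    rw [List.map_append, List.prod_append, List.map_singleton, List.prod_singleton,
      List.length_append, List.length_singleton]
    rcases apply_castSucc_lt_or_gt (l.map s).prod r with h | h
    · rw [card_inversions_mul_s_of_lt h]; omega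
    · have := card_inversions_mul_s_of_gt h; omega

theorem len_eq_card_inversions (w : Equiv.Perm (Fin (m + 1))) :
    len w = (inversions w).card := by
  apply le_antisymm
  · induction w using perm_induction with
    | one => exact (len_prod_le []).trans (Nat.zero_le _)
    | mul_s w r h ih =>
      obtain ⟨l, hl, hlen⟩ := exists_reducedWord w
      calc len (w * s r) = len ((l ++ [r]).map s).prod := by simp [hl]
        _ ≤ (l ++ [r]).length := len_prod_le _
        _ ≤ (inversions (w * s r)).card := by
          rw [card_inversions_mul_s_of_lt h, List.length_append, hlen]; simpa using ih
  · obtain ⟨l, hl, hlen⟩ := exists_reducedWord w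
    simpa only [hl, hlen] using card_inversions_prod_le l

theorem len_one : len (1 : Equiv.Perm (Fin (m + 1))) = 0 :=
  Nat.le_zero.1 (len_prod_le [])

theorem len_mul_s_of_lt (h : w r.castSucc < w r.succ) : len (w * s r) = len w + 1 := by
  rw [len_eq_card_inversions, len_eq_card_inversions, card_inversions_mul_s_of_lt h]

theorem len_mul_s_of_gt (h : w r.succ < w r.castSucc) : len (w * s r) + 1 = len w := by
  rw [len_eq_card_inversions, len_eq_card_inversions, card_inversions_mul_s_of_gt h]

theorem len_inv_le (w : Equiv.Perm (Fin (m + 1))) : len w⁻¹ ≤ len w := by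
  obtain ⟨l, hl, hlen⟩ := exists_reducedWord w
  have hinv : (l.reverse.map s).prod = w⁻¹ := by
    rw [← hl, List.prod_inv_reverse, List.map_map, List.map_reverse]
    congr 3
  simpa only [hinv, List.length_reverse, hlen] using len_prod_le l.reverse

theorem len_inv (w : Equiv.Perm (Fin (m + 1))) : len w⁻¹ = len w :=
  le_antisymm (len_inv_le w) (by simpa using len_inv_le w⁻¹)

theorem len_s_mul_of_lt (h : w⁻¹ r.castSucc < w⁻¹ r.succ) : len (s r * w) = len w + 1 := by
  rw [← len_inv, mul_inv_rev, s_inv, len_mul_s_of_lt h, len_inv]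

theorem len_s_mul_of_gt (h : w⁻¹ r.succ < w⁻¹ r.castSucc) : len (s r * w) + 1 = len w := by
  rw [← len_inv, mul_inv_rev, s_inv, len_mul_s_of_gt h, len_inv]

end Length

/-! ### Parabolic subgroups as stabilisers of weakly increasing functions -/

section Parabolic

variable {m : ℕ}

/-- The positions `r` with `φ r = φ (r + 1)`. For weakly increasing `φ` the corresponding simple
transpositions generate the stabiliser of `φ`; every parabolic subgroup is handled in this form. -/
def ties {α : Type*} [DecidableEq α] (φ : Fin (m + 1) → α) : Finset (Fin m) :=
  {r | φ r.castSucc = φ r.succ}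

section Ties

variable {α : Type*} [DecidableEq α] {φ : Fin (m + 1) → α}

theorem mem_ties {r : Fin m} : r ∈ ties φ ↔ φ r.castSucc = φ r.succ := Finset.mem_filter_univ r

theorem ties_const (c : α) : ties (fun _ : Fin (m + 1) => c) = Finset.univ := by
  simp [ties]

variable [PartialOrder α]

theorem mem_parabolic_ties (hφ : Monotone φ) {w : Equiv.Perm (Fin (m + 1))} :
    w ∈ parabolic (ties φ) ↔ ∀ j, φ (w j) = φ j := by
  constructor
  · intro h
    induction h using Subgroup.closure_induction with
    | mem x hx =>
      obtain ⟨r, hr, rfl⟩ := hx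
      exact apply_s_of_eq (mem_ties.1 hr)
    | one => exact fun _ => rfl
    | mul x y _ _ hx hy => exact fun j => (hx _).trans (hy j)
    | inv x _ hx => exact fun j => by simpa using (hx (x⁻¹ j)).symm
  · refine stabilizer_induction hφ (one_mem _) (fun w r _ hr _ ih => mul_mem ih ?_) w
    exact Subgroup.subset_closure ⟨r, mem_ties.2 hr, rfl⟩

theorem lt_of_lt_on_ties (hφ : Monotone φ) {β : Type*} [Preorder β] {d : Fin (m + 1) → β}
    (hd : ∀ r ∈ ties φ, d r.castSucc < d r.succ) {a b : Fin (m + 1)} (hab : a < b)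
    (h : φ a = φ b) : d a < d b := by
  induction b using Fin.induction with
  | zero => exact absurd hab (Fin.not_lt_zero a)
  | succ r ih =>
    have har : a ≤ r.castSucc := Fin.le_castSucc_iff.2 hab
    have htie : φ r.castSucc = φ r.succ :=
      le_antisymm (hφ Fin.castSucc_lt_succ.le) (h ▸ hφ har)
    have hlt := hd r (mem_ties.2 htie)
    rcases har.eq_or_lt with rfl | har
    · exact hlt
    · exact (ih har (h.trans htie.symm)).trans hlt

end Ties

theorem parabolic_mono {J K : Finset (Fin m)} (h : J ⊆ K) : parabolic J ≤ parabolic K :=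
  Subgroup.closure_mono (Set.image_mono h)

theorem mem_parabolic_univ (w : Equiv.Perm (Fin (m + 1))) :
    w ∈ parabolic (Finset.univ : Finset (Fin m)) := by
  rw [← ties_const (), mem_parabolic_ties monotone_const]
  exact fun _ => rfl

theorem s_mem_parabolic {J : Finset (Fin m)} {r : Fin m} (h : r ∈ J) : s r ∈ parabolic J :=
  Subgroup.subset_closure ⟨r, h, rfl⟩

section CosetReps

variable {K J : Finset (Fin m)} {d d' w : Equiv.Perm (Fin (m + 1))}

theorem mem_cosetReps :
    d ∈ cosetReps K J ↔ d ∈ parabolic K ∧ ∀ v ∈ parabolic J, len d ≤ len (d * v) := by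
  classical
  exact Finset.mem_filter_univ d

theorem mem_parabolic_of_mem_cosetReps (hd : d ∈ cosetReps K J) : d ∈ parabolic K :=
  (mem_cosetReps.1 hd).1

theorem lt_of_mem_cosetReps (hd : d ∈ cosetReps K J) {r : Fin m} (hr : r ∈ J) :
    d r.castSucc < d r.succ := by
  refine (apply_castSucc_lt_or_gt d r).resolve_right fun h => ?_
  have hle := (mem_cosetReps.1 hd).2 _ (s_mem_parabolic hr)
  have hlen := len_mul_s_of_gt h
  omega

theorem exists_mem_cosetReps_mul (hJK : J ⊆ K) (hw : w ∈ parabolic K) :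
    ∃ d ∈ cosetReps K J, ∃ v ∈ parabolic J, w = d * v := by
  classical
  obtain ⟨v, hv, hmin⟩ := Finset.exists_min_image {v | v ∈ parabolic J} (fun v => len (w * v))
    ⟨1, by simp [one_mem]⟩
  rw [Finset.mem_filter_univ] at hv
  refine ⟨w * v, mem_cosetReps.2 ⟨mul_mem hw (parabolic_mono hJK hv), fun x hx => ?_⟩, v⁻¹,
    inv_mem hv, by group⟩
  rw [mul_assoc]
  exact hmin _ (by simpa using mul_mem hv hx)

theorem eq_of_mem_cosetReps {α : Type*} [DecidableEq α] [PartialOrder α] {φ : Fin (m + 1) → α}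
    (hφ : Monotone φ) (hd : d ∈ cosetReps K (ties φ)) (hd' : d' ∈ cosetReps K (ties φ))
    (h : d⁻¹ * d' ∈ parabolic (ties φ)) : d = d' := by
  by_contra hne
  rw [mem_parabolic_ties hφ] at h
  obtain ⟨r, htie, hr⟩ := exists_descent_of_ne_one hφ h (mt inv_mul_eq_one.1 hne)
  have hlt := lt_of_lt_on_ties hφ (fun r hr => lt_of_mem_cosetReps hd hr) hr
    (by rw [h, h, htie])
  simp only [Equiv.Perm.mul_apply, Equiv.Perm.inv_def, Equiv.apply_symm_apply] at hlt
  exact (lt_of_mem_cosetReps hd' (mem_ties.2 htie)).asymm hlt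

end CosetReps

/-- Whether a position lies after `a`; the corresponding parabolic subgroup is the maximal one
that omits `s a`. -/
def side (a : Fin m) (j : Fin (m + 1)) : Bool := decide (a.castSucc < j)

theorem side_monotone (a : Fin m) : Monotone (side a) := fun j l hjl => by
  simpa only [Bool.le_iff_imp, side, decide_eq_true_eq] using (·.trans_le hjl)

theorem ties_side (a : Fin m) : ties (side a) = Finset.univ.erase a := by
  ext r
  rw [mem_ties, Finset.mem_erase]
  simp only [side, decide_eq_decide, Fin.lt_def, Fin.val_castSucc, Fin.val_succ, Finset.mem_univ,
    and_true, ne_eq, Fin.ext_iff]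
  omega

end Parabolic

/-! ### Matsumoto's theorem -/

section Matsumoto

variable {m : ℕ} {w : Equiv.Perm (Fin (m + 1))} {r p : Fin m}

theorem s_apply_castSucc_of_lt (h : (r : ℕ) + 1 < p) : s r p.castSucc = p.castSucc :=
  s_of_ne _ _ (by simp [Fin.ext_iff]; omega) (by simp [Fin.ext_iff]; omega)

theorem s_apply_succ_of_lt (h : r < p) : s r p.succ = p.succ :=
  s_of_ne _ _ (by simp [Fin.ext_iff]; omega) (by simp [Fin.ext_iff]; omega)

theorem s_apply_castSucc_of_gt (h : r < p) : s p r.castSucc = r.castSucc :=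
  s_of_ne _ _ (by simp [Fin.ext_iff]; omega) (by simp [Fin.ext_iff]; omega)

theorem castSucc_eq_succ (h : (r : ℕ) + 1 = p) : p.castSucc = r.succ :=
  Fin.ext h.symm

theorem s_comm (h : (r : ℕ) + 1 < p) : s r * s p = s p * s r := by
  have hconj := Equiv.mul_swap_eq_swap_mul (s r) p.castSucc p.succ
  rwa [s_apply_castSucc_of_lt h, s_apply_succ_of_lt (by omega)] at hconj

theorem s_braid (h : (r : ℕ) + 1 = p) : s r * s p * s r = s p * s r * s p := by
  have hrp : r < p := by omega
  have hadj := castSucc_eq_succ h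
  have hconj := Equiv.mul_swap_eq_swap_mul (s p * s r) p.castSucc p.succ
  rw [Equiv.Perm.mul_apply, Equiv.Perm.mul_apply, hadj, s_succ, s_apply_castSucc_of_gt hrp,
    s_apply_succ_of_lt hrp, s_succ, hadj] at hconj
  have hsp : s p = Equiv.swap r.succ p.succ := by rw [← hadj]; rfl
  calc s r * s p * s r = s r * (s p * s r) := mul_assoc _ _ _
    _ = s p * s r * Equiv.swap r.succ p.succ := hconj.symm
    _ = s p * s r * s p := by rw [← hsp]

/-- `l` is a reduced expression of `w`. -/
def IsReducedWord (l : List (Fin m)) (w : Equiv.Perm (Fin (m + 1))) : Prop :=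
  (l.map s).prod = w ∧ l.length = len w

theorem isReducedWord_cons_iff {l : List (Fin m)} :
    IsReducedWord (r :: l) w ↔ w⁻¹ r.succ < w⁻¹ r.castSucc ∧ IsReducedWord l (s r * w) := by
  constructor
  · rintro ⟨hprod, hlen⟩
    have hl : (l.map s).prod = s r * w := by
      rw [← hprod, List.map_cons, List.prod_cons, s_mul_s_mul]
    rw [List.length_cons] at hlen
    have hle : len (s r * w) ≤ l.length := hl ▸ len_prod_le l
    have hdesc : w⁻¹ r.succ < w⁻¹ r.castSucc :=
      (apply_castSucc_lt_or_gt w⁻¹ r).resolve_left fun h => by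
        have := len_s_mul_of_lt h
        omega
    have := len_s_mul_of_gt hdesc
    exact ⟨hdesc, hl, by omega⟩
  · rintro ⟨hdesc, hl, hlen⟩
    refine ⟨?_, ?_⟩
    · rw [List.map_cons, List.prod_cons, hl, s_mul_s_mul]
    · rw [List.length_cons, hlen, len_s_mul_of_gt hdesc]

theorem exists_isReducedWord_of_comm (h : (r : ℕ) + 1 < p)
    (hr : w⁻¹ r.succ < w⁻¹ r.castSucc) (hp : w⁻¹ p.succ < w⁻¹ p.castSucc) :
    ∃ c, IsReducedWord (r :: p :: c) w ∧ IsReducedWord (p :: r :: c) w := by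
  obtain ⟨c, hc⟩ := exists_reducedWord (s p * (s r * w))
  have hrpc : IsReducedWord (r :: p :: c) w := by
    refine isReducedWord_cons_iff.2 ⟨hr, isReducedWord_cons_iff.2 ⟨?_, hc⟩⟩
    rw [mul_inv_rev, s_inv, Equiv.Perm.mul_apply, Equiv.Perm.mul_apply,
      s_apply_castSucc_of_lt h, s_apply_succ_of_lt (by omega)]
    exact hp
  refine ⟨c, hrpc, ?_, hrpc.2⟩
  simpa only [List.map_cons, List.prod_cons, ← mul_assoc, s_comm h] using hrpc.1

theorem exists_isReducedWord_of_braid (h : (r : ℕ) + 1 = p)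
    (hr : w⁻¹ r.succ < w⁻¹ r.castSucc) (hp : w⁻¹ p.succ < w⁻¹ p.castSucc) :
    ∃ c, IsReducedWord (r :: p :: r :: c) w ∧ IsReducedWord (p :: r :: p :: c) w := by
  have hrp : r < p := by omega
  have hadj := castSucc_eq_succ h
  rw [hadj] at hp
  obtain ⟨c, hc⟩ := exists_reducedWord (s r * (s p * (s r * w)))
  have hrprc : IsReducedWord (r :: p :: r :: c) w := by
    simp only [isReducedWord_cons_iff, mul_inv_rev, s_inv, Equiv.Perm.mul_apply]
    refine ⟨hr, ?_, ?_, hc⟩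
    · rw [hadj, s_apply_succ_of_lt hrp, s_succ]
      exact hp.trans hr
    · rw [s_apply_castSucc_of_gt hrp, ← hadj, s_castSucc, s_apply_succ_of_lt hrp, s_castSucc]
      exact hp
  refine ⟨c, hrprc, ?_, hrprc.2⟩
  simpa only [List.map_cons, List.prod_cons, ← mul_assoc, s_braid h] using hrprc.1

theorem prod_map_eq_of_isReducedWord {M : Type*} [Monoid M] {t : Fin m → M}
    (hcomm : ∀ r p : Fin m, (r : ℕ) + 1 < p → t r * t p = t p * t r)
    (hbraid : ∀ r p : Fin m, (r : ℕ) + 1 = p → t r * t p * t r = t p * t r * t p)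
    {l l' : List (Fin m)} (hl : IsReducedWord l w) (hl' : IsReducedWord l' w) :
    (l.map t).prod = (l'.map t).prod := by
  induction hn : len w generalizing w l l' with
  | zero =>
    rw [List.eq_nil_of_length_eq_zero (hl.2.trans hn),
      List.eq_nil_of_length_eq_zero (hl'.2.trans hn)]
  | succ n ih =>
    have same_head {r : Fin m} {a b : List (Fin m)} (ha : IsReducedWord (r :: a) w)
        (hb : IsReducedWord (r :: b) w) : ((r :: a).map t).prod = ((r :: b).map t).prod := by
      rw [isReducedWord_cons_iff] at ha hb
      have hlen := len_s_mul_of_gt ha.1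
      rw [List.map_cons, List.prod_cons, ih ha.2 hb.2 (by omega), List.map_cons, List.prod_cons]
    obtain ⟨r, a, rfl⟩ := List.exists_cons_of_length_eq_add_one (hl.2.trans hn)
    obtain ⟨p, b, rfl⟩ := List.exists_cons_of_length_eq_add_one (hl'.2.trans hn)
    wlog hrp : r ≤ p generalizing r p a b
    · exact (this p b hl' r a hl (le_of_not_ge hrp)).symm
    have hr := (isReducedWord_cons_iff.1 hl).1
    have hp := (isReducedWord_cons_iff.1 hl').1
    obtain rfl | hadj | hfar : r = p ∨ (r : ℕ) + 1 = p ∨ (r : ℕ) + 1 < p := by omega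
    · exact same_head hl hl'
    · obtain ⟨c, hc, hc'⟩ := exists_isReducedWord_of_braid hadj hr hp
      calc ((r :: a).map t).prod = ((r :: p :: r :: c).map t).prod := same_head hl hc
        _ = ((p :: r :: p :: c).map t).prod := by
          simp only [List.map_cons, List.prod_cons, ← mul_assoc, hbraid r p hadj]
        _ = ((p :: b).map t).prod := same_head hc' hl'
    · obtain ⟨c, hc, hc'⟩ := exists_isReducedWord_of_comm hfar hr hp
      calc ((r :: a).map t).prod = ((r :: p :: c).map t).prod := same_head hl hc
        _ = ((p :: r :: c).map t).prod := by
          simp only [List.map_cons, List.prod_cons, ← mul_assoc, hcomm r p hfar]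
        _ = ((p :: b).map t).prod := same_head hc' hl'

end Matsumoto

/-! ### Standard basis elements of the finite Hecke algebra -/

section FiniteHecke

variable {k : Type*} [Field k] (q : kˣ) {m : ℕ}

section Tw

variable {w : Equiv.Perm (Fin (m + 1))} {r : Fin m}

theorem Tw_eq_prod {l : List (Fin m)} (h : IsReducedWord l w) :
    Tw q w = (l.map (hT q)).prod :=
  prod_map_eq_of_isReducedWord (hT_comm q) (hT_braid q) (exists_reducedWord w).choose_spec h

theorem Tw_one : Tw q (1 : Equiv.Perm (Fin (m + 1))) = 1 :=
  Tw_eq_prod q (l := []) ⟨rfl, len_one.symm⟩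

theorem Tw_mul_s (h : w r.castSucc < w r.succ) : Tw q (w * s r) = Tw q w * hT q r := by
  obtain ⟨l, hl⟩ := exists_reducedWord w
  have hlr : IsReducedWord (l ++ [r]) (w * s r) :=
    ⟨by simp [hl.1], by simp [hl.2, len_mul_s_of_lt h]⟩
  rw [Tw_eq_prod q hl, Tw_eq_prod q hlr]
  simp

theorem Tw_s_mul (h : w⁻¹ r.castSucc < w⁻¹ r.succ) : Tw q (s r * w) = hT q r * Tw q w := by
  obtain ⟨l, hl⟩ := exists_reducedWord w
  have hrl : IsReducedWord (r :: l) (s r * w) :=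
    ⟨by simp [hl.1], by simp [hl.2, len_s_mul_of_lt h]⟩
  rw [Tw_eq_prod q hl, Tw_eq_prod q hrl, List.map_cons, List.prod_cons]

end Tw

open Classical in
/-- The elements of the parabolic subgroup generated by `J`. -/
def parabolicFinset (J : Finset (Fin m)) : Finset (Equiv.Perm (Fin (m + 1))) :=
  {w | w ∈ parabolic J}

theorem mem_parabolicFinset {J : Finset (Fin m)} {w : Equiv.Perm (Fin (m + 1))} :
    w ∈ parabolicFinset J ↔ w ∈ parabolic J := by
  classical
  exact Finset.mem_filter_univ w

theorem parabolicFinset_univ :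
    parabolicFinset (Finset.univ : Finset (Fin m)) = Finset.univ :=
  Finset.eq_univ_of_forall fun w => mem_parabolicFinset.2 (mem_parabolic_univ w)

theorem vHash_eq (J : Finset (Fin m)) :
    vHash q J = hash q (∑ w ∈ parabolicFinset J, Tw q w) := by
  rw [map_sum]
  rfl

section Ties

variable {α : Type*} [DecidableEq α] [PartialOrder α] {φ : Fin (m + 1) → α}

theorem Tw_mul (hφ : Monotone φ) {d v : Equiv.Perm (Fin (m + 1))}
    (hd : ∀ r ∈ ties φ, d r.castSucc < d r.succ) (hv : v ∈ parabolic (ties φ)) :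
    Tw q (d * v) = Tw q d * Tw q v := by
  rw [mem_parabolic_ties hφ] at hv
  refine stabilizer_induction hφ ?_ (fun w r hw hr hlt ih => ?_) v hv
  · rw [mul_one, Tw_one, mul_one]
  · have hdw : (d * w) r.castSucc < (d * w) r.succ :=
      lt_of_lt_on_ties hφ hd hlt (by rw [hw, hw, hr])
    rw [← mul_assoc, Tw_mul_s q hdw, Tw_mul_s q hlt, ih, mul_assoc]

theorem sum_cosetReps (hφ : Monotone φ) {K : Finset (Fin m)}
    (hK : ties φ ⊆ K) {M : Type*} [AddCommMonoid M]
    (f : Equiv.Perm (Fin (m + 1)) → M) :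
    ∑ w ∈ parabolicFinset K, f w =
      ∑ d ∈ cosetReps K (ties φ), ∑ v ∈ parabolicFinset (ties φ), f (d * v) := by
  rw [← Finset.sum_product']
  symm
  refine Finset.sum_bij (fun p _ => p.1 * p.2) ?_ ?_ ?_ fun _ _ => rfl
  · rintro ⟨d, v⟩ hdv
    rw [Finset.mem_product, mem_parabolicFinset] at hdv
    exact mem_parabolicFinset.2 <|
      mul_mem (mem_parabolic_of_mem_cosetReps hdv.1) (parabolic_mono hK hdv.2)
  · rintro ⟨d, v⟩ hdv ⟨d', v'⟩ hdv' (heq : d * v = d' * v')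
    rw [Finset.mem_product, mem_parabolicFinset] at hdv hdv'
    have hquot : d⁻¹ * d' = v * v'⁻¹ := by
      rw [inv_mul_eq_iff_eq_mul, ← mul_assoc, heq, mul_inv_cancel_right]
    obtain rfl : d = d' :=
      eq_of_mem_cosetReps hφ hdv.1 hdv'.1 (hquot ▸ mul_mem hdv.2 (inv_mem hdv'.2))
    rw [mul_left_cancel heq]
  · intro w hw
    obtain ⟨d, hd, v, hv, rfl⟩ := exists_mem_cosetReps_mul hK (mem_parabolicFinset.1 hw)
    exact ⟨(d, v), Finset.mem_product.2 ⟨hd, mem_parabolicFinset.2 hv⟩, rfl⟩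

theorem vHash_eq_mul_vHash_ties (hφ : Monotone φ) {K : Finset (Fin m)} (hK : ties φ ⊆ K) :
    vHash q K = hash q (∑ d ∈ cosetReps K (ties φ), Tw q d) * vHash q (ties φ) := by
  rw [vHash_eq, vHash_eq, ← map_mul, sum_cosetReps hφ hK, Finset.sum_mul_sum]
  congr 1
  exact Finset.sum_congr rfl fun d hd => Finset.sum_congr rfl fun v hv =>
    Tw_mul q hφ (fun r hr => lt_of_mem_cosetReps hd hr) (mem_parabolicFinset.1 hv)

end Ties

theorem sum_Tw_eq_one_add_hT_mul {J : Finset (Fin m)} {r : Fin m} (hr : r ∈ J) :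
    ∑ w ∈ parabolicFinset J, Tw q w =
      (1 + hT q r) * ∑ w ∈ parabolicFinset J with w⁻¹ r.castSucc < w⁻¹ r.succ, Tw q w := by
  have inv_s_mul (w : Equiv.Perm (Fin (m + 1))) :
      (s r * w)⁻¹ r.castSucc = w⁻¹ r.succ ∧ (s r * w)⁻¹ r.succ = w⁻¹ r.castSucc := by
    simp only [mul_inv_rev, s_inv, Equiv.Perm.mul_apply, s_castSucc, s_succ, and_self]
  have s_mul_mem (w : Equiv.Perm (Fin (m + 1))) :
      s r * w ∈ parabolicFinset J ↔ w ∈ parabolicFinset J := by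
    rw [mem_parabolicFinset, mem_parabolicFinset]
    exact Subgroup.mul_mem_cancel_left _ (s_mem_parabolic hr)
  rw [← Finset.sum_filter_add_sum_filter_not _ fun w => w⁻¹ r.castSucc < w⁻¹ r.succ, add_mul,
    one_mul, Finset.mul_sum]
  congr 1
  refine Finset.sum_bij' (fun w _ => s r * w) (fun w _ => s r * w) (fun w hw => ?_)
    (fun w hw => ?_) (fun w _ => s_mul_s_mul w r) (fun w _ => s_mul_s_mul w r) fun w hw => ?_
  all_goals rw [Finset.mem_filter] at hw
  · rw [Finset.mem_filter, s_mul_mem, (inv_s_mul w).1, (inv_s_mul w).2]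
    exact ⟨hw.1, (apply_castSucc_lt_or_gt w⁻¹ r).resolve_left hw.2⟩
  · rw [Finset.mem_filter, s_mul_mem, (inv_s_mul w).1, (inv_s_mul w).2]
    exact ⟨hw.1, hw.2.not_gt⟩
  · rw [← Tw_s_mul, s_mul_s_mul]
    rw [(inv_s_mul w).1, (inv_s_mul w).2]
    exact (apply_castSucc_lt_or_gt w⁻¹ r).resolve_left hw.2

theorem hash_hT (r : Fin m) : hash q (hT q r) = algebraMap k _ (q - 1 : k) - hT q r := by
  simp [hash, hT, hashGen]

theorem hT_mul_one_add (r : Fin m) :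
    hT q r * (1 + hT q r) = algebraMap k _ (q : k) * (1 + hT q r) := by
  rw [mul_add, hT_quad, map_sub, map_one, mul_one, sub_mul, one_mul, mul_add, mul_one]
  abel

theorem hash_hT_mul_vHash {J : Finset (Fin m)} {r : Fin m} (hr : r ∈ J) :
    hash q (hT q r) * vHash q J = (q : k) • vHash q J := by
  rw [vHash_eq, sum_Tw_eq_one_add_hT_mul q hr, ← map_mul, ← mul_assoc, hT_mul_one_add, mul_assoc,
    ← Algebra.smul_def, map_smul]

theorem doubleCosetOne_of_subset {J K : Finset (Fin m)} (h : J ⊆ K) :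
    doubleCosetOne K J = parabolicFinset K := by
  classical
  ext w
  simp only [doubleCosetOne, Finset.mem_filter_univ, mem_parabolicFinset]
  constructor
  · rintro ⟨x, hx, y, hy, rfl⟩
    exact mul_mem hx (parabolic_mono h hy)
  · exact fun hw => ⟨w, hw, 1, one_mem _, (mul_one w).symm⟩

theorem sum_hash_Tw_doubleCosetOne {J K : Finset (Fin m)} (h : J ⊆ K) :
    ∑ w ∈ doubleCosetOne K J, hash q (Tw q w) = vHash q K := by
  rw [doubleCosetOne_of_subset h, vHash_eq, map_sum]

end FiniteHecke

/-! ### The basis element of the completed Schur algebra -/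

section BasisElement

variable {k : Type*} [Field k] {q : kˣ} {m : ℕ} {i : Fin (m + 1) → Residue q}
  {J K : Finset (Fin m)} {h : HeckeHat i} {φ ψ : SchurHat i}

/-- Left multiplication by an element that sends `v_J^♯` to `v_K^♯`, as a map of right ideals. -/
def mulLeftVIdeal (h : HeckeHat i) (hh : h * toHat i (vHash q J) = toHat i (vHash q K)) :
    vIdeal i J →ₗ[(HeckeHat i)ᵐᵒᵖ] vIdeal i K where
  toFun x := ⟨h * x.1, by
    obtain ⟨c, hc⟩ := Submodule.mem_span_singleton.1 x.2
    rw [← hc, MulOpposite.smul_eq_mul_unop, ← mul_assoc, hh]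
    exact Submodule.mem_span_singleton.2 ⟨c, MulOpposite.smul_eq_mul_unop _ _⟩⟩
  map_add' x y := Subtype.ext (mul_add _ _ _)
  map_smul' c x := Subtype.ext (by
    change h * (c • (x : HeckeHat i)) = c • (h * (x : HeckeHat i))
    rw [MulOpposite.smul_eq_mul_unop, MulOpposite.smul_eq_mul_unop, mul_assoc])

theorem IsBasisOne.unique (hφ : IsBasisOne K J φ) (hψ : IsBasisOne K J ψ) : φ = ψ := by
  refine LinearMap.pi_ext fun L x => ?_
  rcases eq_or_ne L J with rfl | hL
  · obtain ⟨c, hc⟩ := Submodule.mem_span_singleton.1 x.2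
    obtain rfl : c • vGen i L = x := Subtype.ext hc
    rw [Pi.single_smul, map_smul, map_smul]
    congr 1
    funext N
    exact Subtype.ext ((hφ.1 N).trans (hψ.1 N).symm)
  · rw [hφ.2 L hL, hψ.2 L hL]

theorem exists_isBasisOne (hJK : J ⊆ K)
    (hh : h * toHat i (vHash q J) = toHat i (vHash q K)) :
    ∃ φ : SchurHat i, IsBasisOne K J φ := by
  refine ⟨LinearMap.single _ _ K ∘ₗ mulLeftVIdeal h hh ∘ₗ
    LinearMap.proj (φ := fun J => vIdeal i J) J, fun L => ?_, fun J' hJ' x => ?_⟩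
  · rw [sum_hash_Tw_doubleCosetOne q hJK, LinearMap.comp_apply, LinearMap.comp_apply,
      LinearMap.proj_apply, Pi.single_eq_same, LinearMap.single_apply]
    split_ifs with hL
    · subst hL
      rw [Pi.single_eq_same]
      exact hh
    · rw [Pi.single_eq_of_ne hL]
      rfl
  · rw [LinearMap.comp_apply, LinearMap.comp_apply, LinearMap.proj_apply,
      Pi.single_eq_of_ne hJ'.symm, map_zero, map_zero]

theorem IsBasisOne.coeffHat_mul (hJK : J ⊆ K)
    (hh : h * toHat i (vHash q J) = toHat i (vHash q K)) (hφ : IsBasisOne K J φ)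
    (L : Finset (Fin m)) :
    coeffHat φ L J * toHat i (vHash q J) = if L = K then toHat i (vHash q K) else 0 := by
  have hcomponent := hφ.1 L
  rw [sum_hash_Tw_doubleCosetOne q hJK] at hcomponent
  have hfactor : ∃ x : HeckeHat i, (φ (Pi.single J (vGen i J)) L : HeckeHat i) =
      x * toHat i (vHash q J) := by
    rw [hcomponent]
    split_ifs
    · exact ⟨h, hh.symm⟩
    · exact ⟨0, (zero_mul _).symm⟩
  rw [← hcomponent, coeffHat, dif_pos hfactor]
  exact hfactor.choose_spec.symm

theorem IsBasisOne.coeffHat_mul_self (hJK : J ⊆ K)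
    (hh : h * toHat i (vHash q J) = toHat i (vHash q K)) (hφ : IsBasisOne K J φ) :
    coeffHat φ K J * toHat i (vHash q J) = toHat i (vHash q K) := by
  rw [hφ.coeffHat_mul hJK hh, if_pos rfl]

end BasisElement

/-! ### Twisted combinations of permutations on fractions -/

section SkewOperators

variable {k : Type*} [Field k] {q : kˣ} {m : ℕ} {i : Fin (m + 1) → Residue q}
  {c c' : Equiv.Perm (Fin (m + 1)) → FracRep i}

theorem permF_one (f : FracRep i) : permF 1 f = f := by
  funext u
  obtain ⟨a, b, _, hab⟩ := IsFractionRing.div_surjective (A := PS k m) (f u)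
  rw [permF_apply, inv_one, one_smul, ← hab, map_div₀, permFrac_algebraMap, permFrac_algebraMap,
    permPS_one, permPS_one]

theorem permF_inv_permF (w : Equiv.Perm (Fin (m + 1))) (f : FracRep i) :
    permF w⁻¹ (permF w f) = f := by
  rw [permF_permF, inv_mul_cancel, permF_one]

theorem permF_theta (w : Equiv.Perm (Fin (m + 1))) (j l : Fin (m + 1)) :
    permF w (theta i j l) = theta i (w j) (w l) := by
  simp only [theta, permF_div, map_sub, map_mul, permF_qF, permF_XF]

theorem theta_ne_zero {j l : Fin (m + 1)} (h : j ≠ l) (u : Orb i) : theta i j l u ≠ 0 := by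
  classical
  have hnum : MvPowerSeries.C (q : k) * Xel i j u - Xel i l u ≠ 0 := fun h0 => by
    have hcoeff := congrArg (MvPowerSeries.coeff (Finsupp.single l 1)) h0
    simp [Xel, MvPowerSeries.coeff_C, MvPowerSeries.coeff_X, Finsupp.single_left_inj, h.symm,
      mul_add, MvPowerSeries.coeff_C_mul] at hcoeff
  refine div_ne_zero (fun h0 => hnum ?_) (XF_sub_ne l j h.symm u)
  apply IsFractionRing.injective (PS k m) (PSFrac k m)
  rw [map_sub, map_mul, map_zero, ← h0]
  rfl

/-- The element `∑_v c_v v` of the skew group algebra of `W` over the fractions, as an operator. -/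
def skewOp (c : Equiv.Perm (Fin (m + 1)) → FracRep i) (f : FracRep i) : FracRep i :=
  ∑ v, c v * permF v f

-- Evaluated at `u`, the permutations are distinct multiplicative maps into a field, so Dedekind's
-- independence of characters applies.
theorem eq_zero_of_skewOp_toFrac_eq_zero (h : ∀ f : PolyRep i, skewOp c (toFrac f) = 0) :
    c = 0 := by
  funext v u
  let χ (w : Equiv.Perm (Fin (m + 1))) : PolyRep i →* PSFrac k m :=
    (((Pi.evalRingHom _ u).comp (permF w)).comp toFrac : PolyRep i →+* PSFrac k m)
  have hχ : Function.Injective χ := fun w w' hww' => by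
    ext j
    by_contra hne
    have hX : permF w (XF i j) u = permF w' (XF i j) u := DFunLike.congr_fun hww' (Xel i j)
    rw [permF_XF, permF_XF] at hX
    exact XF_sub_ne (w' j) (w j) (fun e => hne (by rw [e])) u (sub_eq_zero.2 hX)
  have hindep := (linearIndependent_monoidHom (PolyRep i) (PSFrac k m)).comp χ hχ
  refine Fintype.linearIndependent_iff.1 hindep (fun v => c v u) ?_ v
  funext f
  simpa [skewOp, Finset.sum_apply, χ] using congrFun (h f) u

theorem skewOp_toFrac_injective
    (h : ∀ f : PolyRep i, skewOp c (toFrac f) = skewOp c' (toFrac f)) : c = c' := by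
  refine sub_eq_zero.1 (eq_zero_of_skewOp_toFrac_eq_zero fun f => ?_)
  rw [← sub_eq_zero.2 (h f)]
  simp only [skewOp, Pi.sub_apply, sub_mul, Finset.sum_sub_distrib]

theorem permF_skewOp (w : Equiv.Perm (Fin (m + 1))) (f : FracRep i) :
    permF w (skewOp c f) = skewOp (fun v => permF w (c (w⁻¹ * v))) f := by
  rw [skewOp, skewOp, map_sum]
  refine Fintype.sum_equiv (Equiv.mulLeft w) _ _ fun v => ?_
  simp only [Equiv.coe_mulLeft, inv_mul_cancel_left, map_mul, permF_permF]

end SkewOperators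

/-! ### The symmetrisers in the polynomial representation -/

section Symmetrisers

variable {k : Type*} [Field k] {q : kˣ} {m : ℕ} {i : Fin (m + 1) → Residue q}

theorem heckeRep_hT (r : Fin m) (f : PolyRep i) : heckeRep i (hT q r) f = opT r f := by
  simp [heckeRep, hT, opGen]

theorem toFrac_hash_hT (r : Fin m) (f : PolyRep i) :
    toFrac (heckeRep i (hash q (hT q r)) f) =
      (qF i - theta i r.succ r.castSucc) * toFrac f +
        theta i r.succ r.castSucc * permF (s r) (toFrac f) := by
  rw [hash_hT, map_sub, AlgHom.commutes, LinearMap.sub_apply, Module.algebraMap_end_apply,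
    heckeRep_hT, map_sub, toFrac_opT, sub_smul, one_smul, map_sub, toFrac_algebraMap_mul, theta]
  ring

section SkewExpansion

variable {α : Type*} {φ : Fin (m + 1) → α} {w : Equiv.Perm (Fin (m + 1))} {r : Fin m}
  {c : Equiv.Perm (Fin (m + 1)) → FracRep i}

/-- The skew operator `c` is the action of `T_w^♯`, it involves only permutations preserving `φ`,
and it is unitriangular for the length up to the explicit leading coefficient at `w`. -/
structure IsSkewExpansion (φ : Fin (m + 1) → α) (w : Equiv.Perm (Fin (m + 1)))
    (c : Equiv.Perm (Fin (m + 1)) → FracRep i) : Prop where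
  toFrac_Tw : ∀ f, toFrac (heckeRep i (hash q (Tw q w)) f) = skewOp c (toFrac f)
  preserves : ∀ v, c v ≠ 0 → ∀ j, φ (v j) = φ j
  eq_or_len_lt : ∀ v, c v ≠ 0 → v = w ∨ len v < len w
  leading : c w = ∏ p ∈ inversions w⁻¹, theta i p.2 p.1

theorem IsSkewExpansion.one : IsSkewExpansion (i := i) φ 1 (Pi.single 1 1) := by
  have eq_one (v : Equiv.Perm (Fin (m + 1)))
      (hv : Pi.single (M := fun _ => FracRep i) 1 1 v ≠ 0) : v = 1 :=
    by_contra fun h => hv (Pi.single_eq_of_ne h 1)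
  refine ⟨fun f => ?_, fun v hv j => ?_, fun v hv => Or.inl (eq_one v hv), ?_⟩
  · rw [skewOp, Finset.sum_eq_single_of_mem 1 (Finset.mem_univ _) fun v _ hv => by
      rw [Pi.single_eq_of_ne hv, zero_mul]]
    rw [Pi.single_eq_same, one_mul, permF_one, Tw_one, map_one, map_one, Module.End.one_apply]
  · rw [eq_one v hv, Equiv.Perm.one_apply]
  · rw [Pi.single_eq_same, inv_one, inversions_one, Finset.prod_empty]

/-- The coefficients of the composite of `T_r^♯` with the skew operator `c`. -/
def hashHTCoeff (r : Fin m) (c : Equiv.Perm (Fin (m + 1)) → FracRep i)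
    (v : Equiv.Perm (Fin (m + 1))) : FracRep i :=
  (qF i - theta i r.succ r.castSucc) * c v + theta i r.succ r.castSucc * permF (s r) (c (s r * v))

theorem hashHTCoeff_ne_zero {v : Equiv.Perm (Fin (m + 1))} (h : hashHTCoeff r c v ≠ 0) :
    c v ≠ 0 ∨ c (s r * v) ≠ 0 := by
  contrapose! h
  rw [hashHTCoeff, h.1, h.2, map_zero, mul_zero, mul_zero, add_zero]

theorem toFrac_hash_hT_mul {x : Hecke q m}
    (hx : ∀ f, toFrac (heckeRep i x f) = skewOp c (toFrac f)) (f : PolyRep i) :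
    toFrac (heckeRep i (hash q (hT q r) * x) f) = skewOp (hashHTCoeff r c) (toFrac f) := by
  rw [map_mul, Module.End.mul_apply, toFrac_hash_hT, hx, permF_skewOp, s_inv]
  simp only [skewOp, hashHTCoeff, Finset.mul_sum, add_mul, Finset.sum_add_distrib, mul_assoc]

theorem IsSkewExpansion.s_mul (hc : IsSkewExpansion φ w c) (hr : φ r.castSucc = φ r.succ)
    (hlt : w⁻¹ r.castSucc < w⁻¹ r.succ) : IsSkewExpansion φ (s r * w) (hashHTCoeff r c) := by
  have hlen := len_s_mul_of_lt hlt
  refine ⟨?_, fun v hv => ?_, fun v hv => ?_, ?_⟩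
  · rw [Tw_s_mul q hlt, map_mul]
    exact toFrac_hash_hT_mul hc.toFrac_Tw
  · rcases hashHTCoeff_ne_zero hv with hv | hv
    · exact hc.preserves v hv
    · exact fun j => (apply_s_of_eq hr (v j)).symm.trans (hc.preserves _ hv j)
  · rcases hashHTCoeff_ne_zero hv with hv | hv
    · rcases hc.eq_or_len_lt v hv with rfl | hlt <;> omega
    · rcases hc.eq_or_len_lt _ hv with rfl | hlt
      · rw [s_mul_s_mul]
        exact Or.inl rfl
      · rcases apply_castSucc_lt_or_gt v⁻¹ r with hv | hv
        · have := len_s_mul_of_lt hv; omega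
        · have := len_s_mul_of_gt hv; omega
  · have hzero : c (s r * w) = 0 := by
      by_contra hne
      rcases hc.eq_or_len_lt _ hne with heq | hlt
      · rw [heq] at hlen; omega
      · omega
    rw [hashHTCoeff, hzero, mul_zero, zero_add, s_mul_s_mul, hc.leading, mul_inv_rev, s_inv,
      map_prod, prod_inversions_mul_s hlt]
    simp only [permF_theta]

theorem exists_isSkewExpansion [PartialOrder α] (hφ : Monotone φ) (hw : ∀ j, φ (w j) = φ j) :
    ∃ c : Equiv.Perm (Fin (m + 1)) → FracRep i, IsSkewExpansion φ w c := by
  suffices ∀ x : Equiv.Perm (Fin (m + 1)), (∀ j, φ (x j) = φ j) →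
      ∃ c : Equiv.Perm (Fin (m + 1)) → FracRep i, IsSkewExpansion φ x⁻¹ c by
    simpa using this w⁻¹ fun j => by simpa using (hw (w⁻¹ j)).symm
  refine stabilizer_induction hφ ⟨Pi.single 1 1, ?_⟩ ?_
  · rw [inv_one]
    exact IsSkewExpansion.one
  · rintro x r - hr hlt ⟨c, hc⟩
    rw [mul_inv_rev, s_inv]
    exact ⟨_, hc.s_mul hr (by simpa using hlt)⟩

end SkewExpansion

section Invariance

variable {J : Finset (Fin m)} {w : Equiv.Perm (Fin (m + 1))}

theorem permF_eq_of_mem_parabolic {g : FracRep i} (hg : ∀ r ∈ J, permF (s r) g = g)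
    (hw : w ∈ parabolic J) : permF w g = g := by
  induction hw using Subgroup.closure_induction with
  | mem x hx =>
    obtain ⟨r, hr, rfl⟩ := hx
    exact hg r hr
  | one => exact permF_one g
  | mul x y _ _ hx hy => rw [← permF_permF, hy, hx]
  | inv x _ hx => exact (congrArg (permF x⁻¹) hx).symm.trans (permF_inv_permF x g)

theorem permF_toFrac_vHash (hw : w ∈ parabolic J) (f : PolyRep i) :
    permF w (toFrac (heckeRep i (vHash q J) f)) = toFrac (heckeRep i (vHash q J) f) := by
  refine permF_eq_of_mem_parabolic (fun r hr => ?_) hw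
  have heigen := congrArg (fun x => toFrac (heckeRep i x f)) (hash_hT_mul_vHash q hr)
  simp only [map_mul, Module.End.mul_apply, toFrac_hash_hT, map_smul, LinearMap.smul_apply,
    toFrac_algebraMap_mul] at heigen
  funext u
  have heigen_u := congrFun heigen u
  simp only [Pi.add_apply, Pi.mul_apply, Pi.sub_apply] at heigen_u
  apply mul_left_cancel₀ (theta_ne_zero (i := i) (castSucc_ne_succ r).symm u)
  linear_combination heigen_u

theorem coeff_mul_of_permF_skewOp {c : Equiv.Perm (Fin (m + 1)) → FracRep i}
    (h : ∀ f : PolyRep i, permF w (skewOp c (toFrac f)) = skewOp c (toFrac f))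
    (v : Equiv.Perm (Fin (m + 1))) : c (w * v) = permF w (c v) := by
  have hc : (fun v => permF w (c (w⁻¹ * v))) = c :=
    skewOp_toFrac_injective fun f => by rw [← permF_skewOp, h]
  rw [← congrFun hc (w * v), inv_mul_cancel_left]

end Invariance

/-- The pairs of positions in the same block of `φ`. For weakly increasing `φ` these are the
inversions of the longest element of the corresponding parabolic subgroup. -/
def tiedPairs {α : Type*} [DecidableEq α] (φ : Fin (m + 1) → α) :
    Finset (Fin (m + 1) × Fin (m + 1)) :=
  {p | p.1 < p.2 ∧ φ p.1 = φ p.2}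

theorem mem_tiedPairs {α : Type*} [DecidableEq α] {φ : Fin (m + 1) → α}
    {p : Fin (m + 1) × Fin (m + 1)} : p ∈ tiedPairs φ ↔ p.1 < p.2 ∧ φ p.1 = φ p.2 :=
  Finset.mem_filter_univ p

variable (i) in
/-- The product of the `θ_{j,l}` over the pairs `j < l` in the same block of `φ`. -/
def thetaProd {α : Type*} [DecidableEq α] (φ : Fin (m + 1) → α) : FracRep i :=
  ∏ p ∈ tiedPairs φ, theta i p.1 p.2

theorem thetaProd_ne_zero {α : Type*} [DecidableEq α] (φ : Fin (m + 1) → α) (u : Orb i) :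
    thetaProd i φ u ≠ 0 := by
  rw [thetaProd, Finset.prod_apply]
  exact Finset.prod_ne_zero_iff.2 fun p hp => theta_ne_zero (mem_tiedPairs.1 hp).1.ne u

theorem permF_inv_prod_inversions_inv (w : Equiv.Perm (Fin (m + 1))) :
    permF w⁻¹ (∏ p ∈ inversions w⁻¹, theta i p.2 p.1) =
      ∏ p ∈ inversions w, theta i p.1 p.2 := by
  simp only [map_prod, permF_theta]
  refine Finset.prod_nbij' (fun p => (w⁻¹ p.2, w⁻¹ p.1)) (fun p => (w p.2, w p.1))
    (fun p hp => ?_) (fun p hp => ?_) (fun p _ => ?_) (fun p _ => ?_) fun p _ => rfl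
  · rw [mem_inversions] at hp ⊢
    simpa using hp.symm
  · rw [mem_inversions] at hp ⊢
    simpa using hp.symm
  · simp
  · simp

section Ties

variable {α : Type*} [DecidableEq α] [PartialOrder α] {φ : Fin (m + 1) → α}

theorem exists_longest (hφ : Monotone φ) :
    ∃ w₀ ∈ parabolic (ties φ), (∀ w ∈ parabolic (ties φ), len w ≤ len w₀) ∧
      inversions w₀ = tiedPairs φ := by
  obtain ⟨w₀, hw₀, hmax⟩ := Finset.exists_max_image (parabolicFinset (ties φ)) len
    ⟨1, mem_parabolicFinset.2 (one_mem _)⟩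
  simp only [mem_parabolicFinset] at hw₀ hmax
  have hφw₀ := (mem_parabolic_ties hφ).1 hw₀
  have hdesc (r) (hr : r ∈ ties φ) :
      OrderDual.toDual (w₀ r.castSucc) < OrderDual.toDual (w₀ r.succ) := by
    refine (apply_castSucc_lt_or_gt w₀ r).resolve_left fun h => ?_
    have hle := hmax _ (mul_mem hw₀ (s_mem_parabolic hr))
    rw [len_mul_s_of_lt h] at hle
    omega
  refine ⟨w₀, hw₀, hmax, Finset.ext fun p => ?_⟩
  rw [mem_inversions, mem_tiedPairs]
  refine and_congr_right fun hp => ⟨fun h => le_antisymm (hφ hp.le) ?_, ?_⟩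
  · rw [← hφw₀ p.1, ← hφw₀ p.2]
    exact hφ h.le
  · exact lt_of_lt_on_ties hφ hdesc hp

theorem exists_skewOp_vHash (hφ : Monotone φ) :
    ∃ c : Equiv.Perm (Fin (m + 1)) → FracRep i,
      (∀ f, toFrac (heckeRep i (vHash q (ties φ)) f) = skewOp c (toFrac f)) ∧
      (∀ v ∉ parabolicFinset (ties φ), c v = 0) ∧
      ∀ w₀ ∈ parabolic (ties φ), (∀ w ∈ parabolic (ties φ), len w ≤ len w₀) →
        c w₀ = ∏ p ∈ inversions w₀⁻¹, theta i p.2 p.1 := by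
  have preserves {w : Equiv.Perm (Fin (m + 1))} :
      w ∈ parabolicFinset (ties φ) ↔ ∀ j, φ (w j) = φ j :=
    mem_parabolicFinset.trans (mem_parabolic_ties hφ)
  choose! C hC using fun (w : Equiv.Perm (Fin (m + 1))) (hw : ∀ j, φ (w j) = φ j) =>
    exists_isSkewExpansion (i := i) hφ hw
  refine ⟨fun v => ∑ w ∈ parabolicFinset (ties φ), C w v, fun f => ?_, fun v hv => ?_,
    fun w₀ hw₀ hmax => ?_⟩
  · rw [vHash_eq, map_sum, map_sum, LinearMap.sum_apply, map_sum]
    simp only [skewOp, Finset.sum_mul]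
    rw [Finset.sum_comm]
    exact Finset.sum_congr rfl fun w hw => (hC w (preserves.1 hw)).toFrac_Tw f
  · refine Finset.sum_eq_zero fun w hw => by_contra fun h => hv ?_
    exact preserves.2 ((hC w (preserves.1 hw)).preserves v h)
  · rw [← (hC w₀ ((mem_parabolic_ties hφ).1 hw₀)).leading]
    refine Finset.sum_eq_single_of_mem _ (mem_parabolicFinset.2 hw₀) fun w hw hne => ?_
    by_contra h
    rcases (hC w (preserves.1 hw)).eq_or_len_lt _ h with heq | hlt
    · exact hne heq.symm
    · exact hlt.not_ge (hmax _ (mem_parabolicFinset.1 hw))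

-- The coefficient at the longest element is the leading one of `T_{w₀}^♯`; by invariance it
-- determines all the others.
theorem toFrac_vHash (hφ : Monotone φ) (f : PolyRep i) :
    toFrac (heckeRep i (vHash q (ties φ)) f) =
      ∑ w ∈ parabolicFinset (ties φ), permF w (thetaProd i φ * toFrac f) := by
  obtain ⟨c, hc, hsupp, hlead⟩ := exists_skewOp_vHash (i := i) hφ
  have hinv {w : Equiv.Perm (Fin (m + 1))} (hw : w ∈ parabolic (ties φ)) :=
    coeff_mul_of_permF_skewOp (c := c) fun f => by rw [← hc, permF_toFrac_vHash hw]
  obtain ⟨w₀, hw₀, hmax, hw₀_inv⟩ := exists_longest hφ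
  have hone : c 1 = thetaProd i φ := by
    rw [← inv_mul_cancel w₀, hinv (inv_mem hw₀), hlead w₀ hw₀ hmax,
      permF_inv_prod_inversions_inv, hw₀_inv, thetaProd]
  rw [hc, skewOp, ← Finset.sum_subset (Finset.subset_univ (parabolicFinset (ties φ)))
    fun v _ hv => by rw [hsupp v hv, zero_mul]]
  refine Finset.sum_congr rfl fun w hw => ?_
  rw [map_mul, ← hone, ← hinv (mem_parabolicFinset.1 hw), mul_one]

end Ties

end Symmetrisers

/-! ### The adic filtration of the polynomial representation -/

section Filtration

variable {k : Type*} [Field k] {q : kˣ} {m : ℕ} {i : Fin (m + 1) → Residue q}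

theorem heckeRep_hX (j : Fin (m + 1)) (f : PolyRep i) :
    heckeRep i (hX q j) f = Xel i j * f := by
  simp [heckeRep, hX, opGen]

theorem heckeRep_hXinv (j : Fin (m + 1)) (f : PolyRep i) :
    heckeRep i (hXinv q j) f = Xinvel i j * f := by
  simp [heckeRep, hXinv, opGen]

theorem opT_mul_of_invariant {z : PolyRep i} (hz : ∀ w, perm w z = z) (r : Fin m)
    (f : PolyRep i) : opT r (z * f) = z * opT r f := by
  apply toFrac_injective
  rw [map_mul toFrac, toFrac_opT, toFrac_opT, map_mul toFrac, map_mul (permF _),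
    permF_toFrac (s r) z, hz]
  ring

theorem heckeRep_mul_of_invariant {z : PolyRep i} (hz : ∀ w, perm w z = z) (h : Hecke q m)
    (f : PolyRep i) : heckeRep i h (z * f) = z * heckeRep i h f := by
  obtain ⟨x, rfl⟩ := RingQuot.mkAlgHom_surjective k _ h
  induction x using FreeAlgebra.induction generalizing f with
  | grade0 c => simp only [AlgHom.commutes, Module.algebraMap_end_apply, mul_smul_comm]
  | grade1 g =>
    cases g with
    | T r =>
      change heckeRep i (hT q r) _ = _ * heckeRep i (hT q r) _
      rw [heckeRep_hT, heckeRep_hT, opT_mul_of_invariant hz]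
    | X j =>
      change heckeRep i (hX q j) _ = _ * heckeRep i (hX q j) _
      rw [heckeRep_hX, heckeRep_hX, mul_left_comm]
    | Xinv j =>
      change heckeRep i (hXinv q j) _ = _ * heckeRep i (hXinv q j) _
      rw [heckeRep_hXinv, heckeRep_hXinv, mul_left_comm]
  | mul a b ha hb =>
    rw [map_mul (RingQuot.mkAlgHom k _), map_mul (heckeRep i), Module.End.mul_apply,
      Module.End.mul_apply, hb, ha]
  | add a b ha hb => simp only [map_add, LinearMap.add_apply, ha, hb, mul_add]

variable (i) in
/-- The invariant elements of the polynomial representation without constant term, through which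
the kernel of the central character acts. -/
def invariantsNoConst : Set (PolyRep i) :=
  {z | (∀ w, perm w z = z) ∧ ∀ u, MvPowerSeries.constantCoeff (z u) = 0}

variable (i) in
/-- The ideal generated by the invariant elements without constant term. Its powers are stable
under the affine Hecke algebra, unlike those of the ideal of all elements without constant term. -/
def invariantIdeal : Ideal (PolyRep i) := Ideal.span (invariantsNoConst i)

theorem mul_mem_invariantIdeal_pow {z f : PolyRep i} (hz : z ∈ invariantsNoConst i) {n : ℕ}
    (hf : f ∈ invariantIdeal i ^ n) : z * f ∈ invariantIdeal i ^ (n + 1) := by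
  rw [pow_succ']
  exact Ideal.mul_mem_mul (Ideal.subset_span hz) hf

theorem heckeRep_mem_invariantIdeal_pow (h : Hecke q m) {n : ℕ} {f : PolyRep i}
    (hf : f ∈ invariantIdeal i ^ n) : heckeRep i h f ∈ invariantIdeal i ^ n := by
  induction n generalizing f with
  | zero => simp
  | succ n ih =>
    rw [pow_succ'] at hf
    induction hf using Submodule.mul_induction_on' with
    | mem_mul_mem a ha b hb =>
      induction ha using Submodule.span_induction generalizing b with
      | mem z hz =>
        rw [heckeRep_mul_of_invariant hz.1]
        exact mul_mem_invariantIdeal_pow hz (ih hb)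
      | zero => simp
      | add x y _ _ hx hy =>
        rw [add_mul, map_add]
        exact add_mem (hx b hb) (hy b hb)
      | smul c x _ hx =>
        rw [smul_mul_assoc, ← mul_smul_comm]
        exact hx _ (Ideal.mul_mem_left _ c hb)
    | add x _ y _ hx hy =>
      rw [map_add]
      exact add_mem hx hy

theorem constantCoeff_eq_zero_of_mem_invariantIdeal {f : PolyRep i} (hf : f ∈ invariantIdeal i)
    (u : Orb i) : MvPowerSeries.constantCoeff (f u) = 0 := by
  induction hf using Submodule.span_induction with
  | mem z hz => exact hz.2 u
  | zero => exact map_zero _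
  | add x y _ _ hx hy => rw [Pi.add_apply, map_add, hx, hy, add_zero]
  | smul c x _ hx => rw [smul_eq_mul, Pi.mul_apply, map_mul, hx, mul_zero]

theorem le_order_of_mem_invariantIdeal_pow {n : ℕ} {f : PolyRep i}
    (hf : f ∈ invariantIdeal i ^ n) (u : Orb i) : (n : ℕ∞) ≤ (f u).order := by
  induction n generalizing f with
  | zero => simp
  | succ n ih =>
    rw [pow_succ'] at hf
    induction hf using Submodule.mul_induction_on' with
    | mem_mul_mem a ha b hb =>
      refine le_trans ?_ MvPowerSeries.le_order_mul
      rw [Nat.cast_succ, add_comm]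
      refine add_le_add ?_ (ih hb)
      rw [MvPowerSeries.one_le_order_iff_constCoeff_eq_zero]
      exact constantCoeff_eq_zero_of_mem_invariantIdeal ha u
    | add x _ y _ hx hy => exact (le_min hx hy).trans MvPowerSeries.min_order_le_add

/-- The element `X_j` as a unit of the polynomial representation. -/
def XelUnit (i : Fin (m + 1) → Residue q) (j : Fin (m + 1)) : (PolyRep i)ˣ :=
  ⟨Xel i j, Xinvel i j, Xel_mul_inv j, by rw [mul_comm, Xel_mul_inv]⟩

/-- The Laurent monomial with exponent `α`, as a unit of the polynomial representation. -/
def monomialUnit (i : Fin (m + 1) → Residue q) (α : Fin (m + 1) → ℤ) : (PolyRep i)ˣ :=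
  ∏ j, XelUnit i j ^ α j

theorem heckeRep_laurentMonomial (α : Fin (m + 1) → ℤ) :
    heckeRep i (laurentMonomial q α) =
      LinearMap.mulLeft k (monomialUnit i α : PolyRep i) := by
  let ρ : (Hecke q m)ˣ →* (Module.End k (PolyRep i))ˣ := Units.map (heckeRep i : _ →* _)
  let μ : (PolyRep i)ˣ →* (Module.End k (PolyRep i))ˣ :=
    Units.map (Algebra.lmul k (PolyRep i) : _ →* _)
  have map_uX (j) : ρ (uX q j) = μ (XelUnit i j) :=
    Units.ext (LinearMap.ext (heckeRep_hX j))
  have map_monomial : ρ (List.ofFn fun j => uX q j ^ α j).prod = μ (monomialUnit i α) := by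
    rw [monomialUnit, ← List.prod_ofFn, map_list_prod, map_list_prod, List.map_ofFn, List.map_ofFn]
    congr 2
    funext j
    simp only [Function.comp_apply, map_zpow, map_uX]
  exact congrArg Units.val map_monomial

theorem perm_monomialUnit (w : Equiv.Perm (Fin (m + 1))) (α : Fin (m + 1) → ℤ) :
    perm w (monomialUnit i α : PolyRep i) = monomialUnit i (α ∘ (w⁻¹ : Equiv.Perm _)) := by
  have map_XelUnit (j) : Units.map (perm (i := i) w : PolyRep i →* PolyRep i) (XelUnit i j) =
      XelUnit i (w j) :=
    Units.ext (perm_Xel w j)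
  have map_monomial : Units.map (perm (i := i) w : PolyRep i →* PolyRep i) (monomialUnit i α) =
      monomialUnit i (α ∘ (w⁻¹ : Equiv.Perm _)) := by
    rw [monomialUnit, map_prod, monomialUnit]
    refine Fintype.prod_equiv w _ _ fun j => ?_
    simp [map_XelUnit]
  exact congrArg Units.val map_monomial

theorem constantCoeff_monomialUnit (u : Orb i) (α : Fin (m + 1) → ℤ) :
    MvPowerSeries.constantCoeff ((monomialUnit i α : PolyRep i) u) =
      ∏ j, (((q ^ (u.1 j : ℤ)) ^ α j : kˣ) : k) := by
  let χ : PolyRep i →* k :=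
    ((MvPowerSeries.constantCoeff : PS k m →+* k).comp (Pi.evalRingHom _ u) : PolyRep i →+* k)
  have map_XelUnit (j) : Units.map χ (XelUnit i j) = q ^ (u.1 j : ℤ) := by
    apply Units.ext
    change MvPowerSeries.constantCoeff (Xel i j u) = _
    rw [Xel, map_add, MvPowerSeries.constantCoeff_C, MvPowerSeries.constantCoeff_X, add_zero]
  have map_monomial : Units.map χ (monomialUnit i α) = ∏ j, (q ^ (u.1 j : ℤ)) ^ α j := by
    rw [monomialUnit, map_prod]
    exact Finset.prod_congr rfl fun j _ => by rw [map_zpow, map_XelUnit]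
  exact (congrArg Units.val map_monomial).trans (Units.coe_prod _ _)

theorem constantCoeff_perm (w : Equiv.Perm (Fin (m + 1))) (f : PolyRep i) (u : Orb i) :
    MvPowerSeries.constantCoeff (perm w f u) = MvPowerSeries.constantCoeff (f (w⁻¹ • u)) := by
  rw [perm_apply, permPS_apply, MvPowerSeries.constantCoeff_rename]

theorem exists_smul_base (u : Orb i) :
    ∃ w : Equiv.Perm (Fin (m + 1)), w⁻¹ • u = (⟨i, 1, rfl⟩ : Orb i) := by
  obtain ⟨w, hw⟩ := u.2
  refine ⟨w⁻¹, Subtype.ext (funext fun j => ?_)⟩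
  rw [smul_apply, hw]
  simp

variable (i) in
/-- The value of the Laurent polynomial `p` in the polynomial representation. -/
def laurentEval (p : (Fin (m + 1) → ℤ) →₀ k) : PolyRep i :=
  p.sum fun α c => c • (monomialUnit i α : PolyRep i)

theorem perm_laurentEval {p : (Fin (m + 1) → ℤ) →₀ k} {w : Equiv.Perm (Fin (m + 1))}
    (hp : ∀ α, p (α ∘ w) = p α) : perm w (laurentEval i p) = laurentEval i p := by
  have hp' (α : Fin (m + 1) → ℤ) : p (w.arrowCongr (Equiv.refl ℤ) α) = p α := by
    rw [← hp]
    congr 1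
    funext j
    simp
  simp only [laurentEval, Finsupp.sum, map_sum, perm_smul, perm_monomialUnit]
  refine Finset.sum_equiv (w.arrowCongr (Equiv.refl ℤ)) (fun α => ?_) fun α _ => ?_
  · rw [Finsupp.mem_support_iff, Finsupp.mem_support_iff, hp']
  · rw [hp']
    rfl

theorem constantCoeff_laurentEval (p : (Fin (m + 1) → ℤ) →₀ k) (u : Orb i) :
    MvPowerSeries.constantCoeff (laurentEval i p u) =
      p.sum fun α c => c * ∏ j, (((q ^ (u.1 j : ℤ)) ^ α j : kˣ) : k) := by
  rw [laurentEval, Finsupp.sum, Finset.sum_apply, map_sum]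
  refine Finset.sum_congr rfl fun α _ => ?_
  rw [Pi.smul_apply, MvPowerSeries.constantCoeff_smul, constantCoeff_monomialUnit, smul_eq_mul]

theorem exists_heckeRep_eq_mul_of_mem_centralKernel {x : Hecke q m} (hx : x ∈ centralKernel i) :
    ∃ z ∈ invariantsNoConst i, ∀ f, heckeRep i x f = z * f := by
  obtain ⟨p, hsymm, hzero, rfl⟩ := hx
  have hinv (w) : perm w (laurentEval i p) = laurentEval i p := perm_laurentEval (hsymm w)
  refine ⟨laurentEval i p, ⟨hinv, fun u => ?_⟩, fun f => ?_⟩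
  · obtain ⟨w, hw⟩ := exists_smul_base u
    rw [← hinv w, constantCoeff_perm, hw, constantCoeff_laurentEval, hzero]
  · simp only [laurentEval, Finsupp.sum, map_sum, map_smul, LinearMap.sum_apply,
      LinearMap.smul_apply, heckeRep_laurentMonomial, LinearMap.mulLeft_apply, Finset.sum_mul,
      smul_mul_assoc]

theorem heckeRep_mem_of_mem_idealI {x : Hecke q m} (hx : x ∈ idealI i) {n : ℕ} {f : PolyRep i}
    (hf : f ∈ invariantIdeal i ^ n) : heckeRep i x f ∈ invariantIdeal i ^ (n + 1) := by
  induction hx using TwoSidedIdeal.span_induction generalizing f with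
  | mem x hx =>
    obtain ⟨z, hz, h⟩ := exists_heckeRep_eq_mul_of_mem_centralKernel hx
    rw [h]
    exact mul_mem_invariantIdeal_pow hz hf
  | zero => simp
  | add x y _ _ hx hy => rw [map_add]; exact add_mem (hx hf) (hy hf)
  | neg x _ hx => rw [map_neg]; exact neg_mem (hx hf)
  | left_absorb a x _ hx =>
    rw [map_mul, Module.End.mul_apply]
    exact heckeRep_mem_invariantIdeal_pow a (hx hf)
  | right_absorb a x _ hx =>
    rw [map_mul, Module.End.mul_apply]
    exact hx (heckeRep_mem_invariantIdeal_pow a hf)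

theorem heckeRep_list_prod_mem {l : List (Hecke q m)} (hl : ∀ y ∈ l, y ∈ idealI i)
    (f : PolyRep i) : heckeRep i l.prod f ∈ invariantIdeal i ^ l.length := by
  induction l with
  | nil => simp
  | cons y l ih =>
    rw [List.prod_cons, map_mul, Module.End.mul_apply]
    exact heckeRep_mem_of_mem_idealI (hl y List.mem_cons_self)
      (ih fun x hx => hl x (List.mem_cons_of_mem _ hx))

theorem heckeRep_mem_of_mem_idealPow {r : ℕ} {x : Hecke q m} (hx : x ∈ idealPow i r)
    (f : PolyRep i) : heckeRep i x f ∈ invariantIdeal i ^ r := by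
  induction hx using TwoSidedIdeal.span_induction generalizing f with
  | mem x hx =>
    obtain ⟨y, hy, rfl⟩ := hx
    simpa only [List.length_ofFn] using
      heckeRep_list_prod_mem (List.forall_mem_ofFn_iff.2 hy) f
  | zero => simp
  | add x y _ _ hx hy => rw [map_add]; exact add_mem (hx f) (hy f)
  | neg x _ hx => rw [map_neg]; exact neg_mem (hx f)
  | left_absorb a x _ hx =>
    rw [map_mul, Module.End.mul_apply]
    exact heckeRep_mem_invariantIdeal_pow a (hx f)
  | right_absorb a x _ hx =>
    rw [map_mul, Module.End.mul_apply]
    exact hx _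

end Filtration

/-! ### The action of the completed algebra -/

section CompletedAction

variable {k : Type*} [Field k] {q : kˣ} {m : ℕ} {i : Fin (m + 1) → Residue q}

theorem coeff_heckeRep_congr {r : ℕ} {h h' : Hecke q m} (hh : toQuo i r h = toQuo i r h')
    {α : Fin (m + 1) →₀ ℕ} (hα : α.degree < r) (f : PolyRep i) (u : Orb i) :
    MvPowerSeries.coeff α (heckeRep i h f u) = MvPowerSeries.coeff α (heckeRep i h' f u) := by
  have hsub : h - h' ∈ idealPow i r := by
    rw [← TwoSidedIdeal.rel_iff]
    exact (RingCon.eq _).1 hh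
  have horder := le_order_of_mem_invariantIdeal_pow (heckeRep_mem_of_mem_idealPow hsub f) u
  have hcoeff := MvPowerSeries.coeff_of_lt_order ((Nat.cast_lt.2 hα).trans_le horder)
  rw [map_sub, LinearMap.sub_apply, Pi.sub_apply, map_sub] at hcoeff
  exact sub_eq_zero.1 hcoeff

theorem coeff_hatAct {x : HeckeHat i} {r : ℕ} {h : Hecke q m} (hh : toQuo i r h = x.1 r)
    {α : Fin (m + 1) →₀ ℕ} (hα : α.degree < r) (f : PolyRep i) (u : Orb i) :
    MvPowerSeries.coeff α (hatAct i x f u) = MvPowerSeries.coeff α (heckeRep i h f u) := by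
  change MvPowerSeries.coeff α (heckeRep i (approx i (α.degree + 1) x) f u) = _
  obtain ⟨g, hg, hgr⟩ := x.2 (α.degree + 1) r hα
  rw [coeff_heckeRep_congr ((toQuo_approx i _ x).trans hg.symm) (Nat.lt_succ_self _),
    coeff_heckeRep_congr (hgr.trans hh.symm) hα]

theorem hatAct_toHat (h : Hecke q m) (f : PolyRep i) :
    hatAct i (toHat i h) f = heckeRep i h f := by
  funext u
  ext α
  exact coeff_hatAct (r := α.degree + 1) rfl (Nat.lt_succ_self _) f u

theorem hatAct_zero_right (x : HeckeHat i) : hatAct i x 0 = 0 := by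
  funext u
  ext α
  rw [coeff_hatAct (toQuo_approx i _ x) (Nat.lt_succ_self _), map_zero]

theorem hatAct_mul_toHat (x : HeckeHat i) (v : Hecke q m) (f : PolyRep i) :
    hatAct i (x * toHat i v) f = hatAct i x (heckeRep i v f) := by
  funext u
  ext α
  rw [coeff_hatAct (toQuo_approx i _ x) (Nat.lt_succ_self _), ← Module.End.mul_apply, ← map_mul]
  refine coeff_hatAct ?_ (Nat.lt_succ_self _) f u
  rw [map_mul, toQuo_approx]
  rfl

theorem hatAct_mul_of_invariant {z : PolyRep i} (hz : ∀ w, perm w z = z) (x : HeckeHat i)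
    (f : PolyRep i) : hatAct i x (z * f) = z * hatAct i x f := by
  funext u
  ext α
  rw [coeff_hatAct (toQuo_approx i _ x) (Nat.lt_succ_self _), heckeRep_mul_of_invariant hz,
    Pi.mul_apply, Pi.mul_apply, MvPowerSeries.coeff_mul, MvPowerSeries.coeff_mul]
  refine Finset.sum_congr rfl fun p hp => ?_
  rw [coeff_hatAct (toQuo_approx i (α.degree + 1) x)]
  rw [← Finset.HasAntidiagonal.mem_antidiagonal.1 hp, map_add]
  omega

theorem mul_hatAct {x : HeckeHat i} {v y : Hecke q m} (hx : x * toHat i v = toHat i y)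
    {z : PolyRep i} (hz : ∀ w, perm w z = z) {f g : PolyRep i} (hf : z * f = heckeRep i v g) :
    z * hatAct i x f = heckeRep i y g := by
  rw [← hatAct_mul_of_invariant hz, hf, ← hatAct_mul_toHat, hx, hatAct_toHat]

end CompletedAction

/-! ### Inverting the symmetriser on fractions -/

section Denominators

variable {k : Type*} [Field k] {q : kˣ} {m : ℕ} {i : Fin (m + 1) → Residue q}

theorem toFrac_ne_zero {z : PolyRep i} {u : Orb i} (h : z u ≠ 0) : toFrac z u ≠ 0 := by
  rw [toFrac_apply]
  exact (map_ne_zero_iff _ (IsFractionRing.injective (PS k m) (PSFrac k m))).2 h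

theorem det_vandermonde_XF_ne_zero (u : Orb i) : (Matrix.vandermonde (XF i)).det u ≠ 0 := by
  simp only [Matrix.det_vandermonde, Finset.prod_apply]
  exact Finset.prod_ne_zero_iff.2 fun a _ => Finset.prod_ne_zero_iff.2 fun b hb =>
    XF_sub_ne a b (Finset.mem_Ioi.1 hb).ne u

theorem permF_det_vandermonde_XF (w : Equiv.Perm (Fin (m + 1))) :
    permF w (Matrix.vandermonde (XF i)).det =
      (Equiv.Perm.sign w : ℤ) * (Matrix.vandermonde (XF i)).det := by
  rw [← Matrix.det_permute, RingHom.map_det]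
  congr 1
  ext a b
  simp only [RingHom.mapMatrix_apply, Matrix.map_apply, Matrix.vandermonde_apply, map_pow,
    permF_XF, Matrix.submatrix_apply, id]

-- The leading monomial of the Vandermonde determinant divided by that determinant.
theorem exists_sum_permF_eq_one :
    ∃ e : FracRep i, ∑ w : Equiv.Perm (Fin (m + 1)), permF w e = 1 := by
  set V : FracRep i := (Matrix.vandermonde (XF i)).det with hV
  have hdet : V = ∑ w : Equiv.Perm (Fin (m + 1)),
      ((Equiv.Perm.sign w : ℤ) : FracRep i) * ∏ j, XF i (w j) ^ (j : ℕ) := by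
    rw [hV, Matrix.det_apply']
    rfl
  refine ⟨(∏ j, XF i j ^ (j : ℕ)) / V, funext fun u => ?_⟩
  have hperm (w : Equiv.Perm (Fin (m + 1))) : permF w ((∏ j, XF i j ^ (j : ℕ)) / V) =
      ((Equiv.Perm.sign w : ℤ) : FracRep i) * (∏ j, XF i (w j) ^ (j : ℕ)) / V := by
    rw [permF_div, hV, permF_det_vandermonde_XF, map_prod]
    simp only [map_pow, permF_XF]
    funext u
    rcases Int.units_eq_one_or (Equiv.Perm.sign w) with h | h <;> simp [h, neg_div, div_neg]
  simp only [hperm, Finset.sum_apply, Pi.div_apply]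
  rw [← Finset.sum_div, ← Finset.sum_apply, ← hdet, div_self (det_vandermonde_XF_ne_zero u),
    Pi.one_apply]

theorem perm_one (f : PolyRep i) : perm 1 f = f :=
  funext fun u => permPS_one (f u)

theorem perm_perm (w v : Equiv.Perm (Fin (m + 1))) (f : PolyRep i) :
    perm w (perm v f) = perm (w * v) f := by
  funext u
  simp only [perm_apply, permPS_mul, mul_inv_rev, mul_smul]

theorem exists_invariant_multiple {b : PolyRep i} (hb : ∀ u, b u ≠ 0) :
    ∃ z y : PolyRep i, (∀ w, perm w z = z) ∧ (∀ u, z u ≠ 0) ∧ z = y * b := by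
  classical
  refine ⟨∏ w, perm w b, ∏ w ∈ Finset.univ.erase 1, perm w b, fun w => ?_, fun u => ?_, ?_⟩
  · rw [map_prod]
    exact Fintype.prod_equiv (Equiv.mulLeft w) _ _ fun v => perm_perm w v b
  · rw [Finset.prod_apply]
    refine Finset.prod_ne_zero_iff.2 fun w _ => ?_
    rw [perm_apply]
    exact (map_ne_zero_iff _ (permPS k w).injective).2 (hb _)
  · rw [← Finset.prod_erase_mul _ _ (Finset.mem_univ (1 : Equiv.Perm (Fin (m + 1)))), perm_one]

theorem exists_invariant_denominator (G : FracRep i) :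
    ∃ z g : PolyRep i, (∀ w, perm w z = z) ∧ (∀ u, z u ≠ 0) ∧ toFrac z * G = toFrac g := by
  choose a b hb hab using fun u => IsFractionRing.div_surjective (A := PS k m) (G u)
  have hb_ne (u) : b u ≠ 0 := nonZeroDivisors.ne_zero (hb u)
  obtain ⟨z, y, hz, hz_ne, hzy⟩ := exists_invariant_multiple hb_ne
  refine ⟨z, y * a, hz, hz_ne, ?_⟩
  rw [hzy, map_mul, map_mul, mul_assoc]
  congr 1
  funext u
  rw [Pi.mul_apply, ← hab, toFrac_apply]
  exact mul_div_cancel₀ _ (toFrac_ne_zero (hb_ne u))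

variable {α : Type*} [DecidableEq α] [PartialOrder α] {φ : Fin (m + 1) → α}

theorem exists_sum_parabolic_permF_eq_one (hφ : Monotone φ) :
    ∃ e : FracRep i, ∑ w ∈ parabolicFinset (ties φ), permF w e = 1 := by
  obtain ⟨e, he⟩ := exists_sum_permF_eq_one (i := i)
  refine ⟨∑ d ∈ cosetReps Finset.univ (ties φ), permF d⁻¹ e, ?_⟩
  have hinv : ∑ w ∈ parabolicFinset (Finset.univ : Finset (Fin m)), permF w⁻¹ e = 1 := by
    rw [parabolicFinset_univ, ← he]
    exact Fintype.sum_equiv (Equiv.inv _) _ _ fun _ => rfl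
  rw [← hinv, sum_cosetReps hφ (Finset.subset_univ _), Finset.sum_comm]
  refine Finset.sum_equiv (Equiv.inv _) (fun w => ?_) fun w _ => ?_
  · simp [mem_parabolicFinset]
  · simp [map_sum, permF_permF]

theorem exists_invariant_mul_eq_vHash (hφ : Monotone φ) {f : PolyRep i}
    (hf : ∀ w ∈ parabolic (ties φ), perm w f = f) :
    ∃ z g : PolyRep i, (∀ w, perm w z = z) ∧ (∀ u, z u ≠ 0) ∧
      z * f = heckeRep i (vHash q (ties φ)) g := by
  obtain ⟨e, he⟩ := exists_sum_parabolic_permF_eq_one (i := i) hφ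
  obtain ⟨z, g, hz, hz_ne, hg⟩ := exists_invariant_denominator (e * toFrac f / thetaProd i φ)
  refine ⟨z, g, hz, hz_ne, toFrac_injective ?_⟩
  have hcancel : thetaProd i φ * toFrac g = toFrac z * (e * toFrac f) := by
    rw [← hg]
    funext u
    have := thetaProd_ne_zero (i := i) φ u
    simp only [Pi.mul_apply, Pi.div_apply]
    field_simp
  have hperm (w) (hw : w ∈ parabolicFinset (ties φ)) :
      permF w (toFrac z * (e * toFrac f)) = toFrac z * (permF w e * toFrac f) := by
    rw [map_mul, map_mul, permF_toFrac w z, hz, permF_toFrac w f, hf w (mem_parabolicFinset.1 hw)]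
  rw [toFrac_vHash hφ, hcancel, Finset.sum_congr rfl hperm, ← Finset.mul_sum, ← Finset.sum_mul, he,
    one_mul, map_mul]

end Denominators

section CrossTheta

variable {k : Type*} [Field k] {q : kˣ} {m : ℕ} {i : Fin (m + 1) → Residue q}
  {α β : Type*} [DecidableEq α] [PartialOrder α] [DecidableEq β] [PartialOrder β]
  {φ : Fin (m + 1) → α} {ψ : Fin (m + 1) → β}

variable (i) in
/-- The product of the `θ_{j,l}` over the pairs `j < l` in the same block of `ψ` but in different
blocks of `φ`. -/
def crossTheta {α β : Type*} [DecidableEq α] [DecidableEq β] (φ : Fin (m + 1) → α)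
    (ψ : Fin (m + 1) → β) : FracRep i :=
  ∏ p ∈ tiedPairs ψ \ tiedPairs φ, theta i p.1 p.2

theorem tiedPairs_subset (hφ : Monotone φ) (hψ : Monotone ψ) (h : ties φ ⊆ ties ψ) :
    tiedPairs φ ⊆ tiedPairs ψ := by
  intro p hp
  rw [mem_tiedPairs] at hp ⊢
  have hswap : Equiv.swap p.1 p.2 ∈ parabolic (ties φ) := by
    rw [mem_parabolic_ties hφ]
    intro j
    grind
  have hψp := (mem_parabolic_ties hψ).1 (parabolic_mono h hswap) p.1
  rw [Equiv.swap_apply_left] at hψp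
  exact ⟨hp.1, hψp.symm⟩

theorem thetaProd_eq_crossTheta_mul (hφ : Monotone φ) (hψ : Monotone ψ) (h : ties φ ⊆ ties ψ) :
    thetaProd i ψ = crossTheta i φ ψ * thetaProd i φ :=
  (Finset.prod_sdiff (tiedPairs_subset hφ hψ h)).symm

theorem permF_crossTheta (hφ : Monotone φ) (hψ : Monotone ψ) (h : ties φ ⊆ ties ψ)
    {y : Equiv.Perm (Fin (m + 1))} (hy : y ∈ parabolic (ties φ)) :
    permF y (crossTheta i φ ψ) = crossTheta i φ ψ := by
  have hyψ := (mem_parabolic_ties hψ).1 (parabolic_mono h hy)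
  rw [mem_parabolic_ties hφ] at hy
  simp only [crossTheta, map_prod, permF_theta]
  refine Finset.prod_equiv (y.prodCongr y) (fun p => ?_) fun p _ => rfl
  have lt_iff {j l : Fin (m + 1)} (hne : φ j ≠ φ l) : j < l ↔ φ j < φ l :=
    ⟨fun hlt => (hφ hlt.le).lt_of_ne hne, fun hlt => lt_of_not_ge fun hle => (hφ hle).not_gt hlt⟩
  simp only [Finset.mem_sdiff, mem_tiedPairs, Equiv.prodCongr_apply, Prod.map_fst, Prod.map_snd,
    hy, hyψ]
  by_cases hne : φ p.1 = φ p.2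
  · tauto
  · rw [lt_iff hne, lt_iff (by rwa [hy, hy]), hy, hy]

theorem crossTheta_side (a : Fin m) : crossTheta i (side a) (fun _ => ()) =
    ∏ l ∈ Finset.Ioi a.castSucc, ∏ j ∈ Finset.Iic a.castSucc, theta i j l := by
  rw [Finset.prod_comm, ← Finset.prod_product', crossTheta]
  refine Finset.prod_congr (Finset.ext fun p => ?_) fun _ _ => rfl
  simp only [Finset.mem_sdiff, mem_tiedPairs, side, decide_eq_decide, Finset.mem_product,
    Finset.mem_Iic, Finset.mem_Ioi]
  grind

theorem toFrac_vHash_eq_sum_cosetReps (hφ : Monotone φ) (hψ : Monotone ψ) (h : ties φ ⊆ ties ψ)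
    (g : PolyRep i) :
    toFrac (heckeRep i (vHash q (ties ψ)) g) = ∑ d ∈ cosetReps (ties ψ) (ties φ),
      permF d (crossTheta i φ ψ * toFrac (heckeRep i (vHash q (ties φ)) g)) := by
  rw [toFrac_vHash hψ, sum_cosetReps hφ h]
  refine Finset.sum_congr rfl fun d _ => ?_
  rw [toFrac_vHash hφ, Finset.mul_sum, map_sum]
  refine Finset.sum_congr rfl fun v hv => ?_
  rw [← permF_permF, thetaProd_eq_crossTheta_mul hφ hψ h, mul_assoc, map_mul (permF v),
    permF_crossTheta hφ hψ h (mem_parabolicFinset.1 hv)]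

end CrossTheta

section HatAct

variable {k : Type*} [Field k] {q : kˣ} {m : ℕ} {i : Fin (m + 1) → Residue q}
  {α β : Type*} [DecidableEq α] [PartialOrder α] [DecidableEq β] [PartialOrder β]
  {φ : Fin (m + 1) → α} {ψ : Fin (m + 1) → β} {x : HeckeHat i} {f : PolyRep i}

theorem toFrac_hatAct (hφ : Monotone φ) (hψ : Monotone ψ) (h : ties φ ⊆ ties ψ)
    (hx : x * toHat i (vHash q (ties φ)) = toHat i (vHash q (ties ψ)))
    (hf : ∀ w ∈ parabolic (ties φ), perm w f = f) :
    toFrac (hatAct i x f) =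
      ∑ d ∈ cosetReps (ties ψ) (ties φ), permF d (crossTheta i φ ψ * toFrac f) := by
  obtain ⟨z, g, hz, hz_ne, hg⟩ := exists_invariant_mul_eq_vHash hφ hf
  have hscaled : toFrac z * toFrac (hatAct i x f) =
      toFrac z * ∑ d ∈ cosetReps (ties ψ) (ties φ), permF d (crossTheta i φ ψ * toFrac f) := by
    rw [← map_mul, mul_hatAct hx hz hg, toFrac_vHash_eq_sum_cosetReps hφ hψ h, ← hg,
      Finset.mul_sum]
    refine Finset.sum_congr rfl fun d _ => ?_
    rw [map_mul toFrac, mul_left_comm, map_mul (permF d), permF_toFrac d z, hz]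
  exact funext fun u => mul_left_cancel₀ (toFrac_ne_zero (hz_ne u)) (congrFun hscaled u)

theorem perm_hatAct (hφ : Monotone φ) {K : Finset (Fin m)}
    (hx : x * toHat i (vHash q (ties φ)) = toHat i (vHash q K))
    (hf : ∀ w ∈ parabolic (ties φ), perm w f = f) {w : Equiv.Perm (Fin (m + 1))}
    (hw : w ∈ parabolic K) : perm w (hatAct i x f) = hatAct i x f := by
  obtain ⟨z, g, hz, hz_ne, hg⟩ := exists_invariant_mul_eq_vHash hφ hf
  have hscaled : z * perm w (hatAct i x f) = z * hatAct i x f := by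
    apply toFrac_injective
    nth_rw 1 [← hz w]
    rw [← map_mul, ← permF_toFrac, mul_hatAct hx hz hg, permF_toFrac_vHash hw]
  exact funext fun u => mul_left_cancel₀ (hz_ne u) (congrFun hscaled u)

theorem hatAct_eq_zero (hφ : Monotone φ) (hx : x * toHat i (vHash q (ties φ)) = 0)
    (hf : ∀ w ∈ parabolic (ties φ), perm w f = f) : hatAct i x f = 0 := by
  obtain ⟨z, g, hz, hz_ne, hg⟩ := exists_invariant_mul_eq_vHash hφ hf
  have hscaled : z * hatAct i x f = 0 := by
    rw [mul_hatAct (hx.trans (map_zero (toHat i)).symm) hz hg, map_zero, LinearMap.zero_apply]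
  exact funext fun u => (mul_eq_zero.1 (congrFun hscaled u)).resolve_left (hz_ne u)

theorem IsBasisOne.rho_single {b : SchurHat i} {K : Finset (Fin m)} {h : HeckeHat i}
    (hφ : Monotone φ) (hK : ties φ ⊆ K) (hb : IsBasisOne K (ties φ) b)
    (hh : h * toHat i (vHash q (ties φ)) = toHat i (vHash q K))
    (hf : ∀ w ∈ parabolic (ties φ), perm w f = f) :
    rho b (Pi.single (ties φ) f) = Pi.single K (hatAct i (coeffHat b K (ties φ)) f) := by
  funext L
  rw [rho, Finset.sum_eq_single_of_mem (ties φ) (Finset.mem_univ _) fun J _ hJ => by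
    rw [Pi.single_eq_of_ne hJ, hatAct_zero_right], Pi.single_eq_same]
  rcases eq_or_ne L K with rfl | hL
  · rw [Pi.single_eq_same]
  · rw [Pi.single_eq_of_ne hL]
    exact hatAct_eq_zero hφ (by rw [hb.coeffHat_mul hK hh, if_neg hL]) hf

end HatAct

/-! ### Spaces of invariants -/

section Invariants

variable {k : Type*} [Field k] {q : kˣ} {m : ℕ} {i : Fin (m + 1) → Residue q}

theorem smul_eq_self_iff {w : Equiv.Perm (Fin (m + 1))} {u : Orb i} :
    w • u = u ↔ ∀ j, u.1 (w j) = u.1 j := by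
  rw [← inv_smul_eq_iff.trans eq_comm, Subtype.ext_iff, funext_iff]
  exact forall_congr' fun j => by rw [smul_apply, inv_inv]

theorem exists_smul_eq (u v : Orb i) : ∃ w : Equiv.Perm (Fin (m + 1)), w • u = v := by
  obtain ⟨x, hx⟩ := exists_smul_base u
  obtain ⟨y, hy⟩ := exists_smul_base v
  exact ⟨y * x⁻¹, by rw [mul_smul, hx, ← hy, smul_inv_smul]⟩

theorem exists_smul_of_apply_ne_zero {J : Finset (Fin m)} {u v : Orb i} {f : PolyRep i}
    (hf : f ∈ Rhat J u) (hv : f v ≠ 0) : ∃ w ∈ parabolic J, w • u = v := by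
  classical
  obtain ⟨g, -, rfl⟩ := hf
  by_contra! hne
  refine hv ?_
  rw [xi, Finset.sum_apply]
  exact Finset.sum_eq_zero fun d hd =>
    Pi.single_eq_of_ne (hne d (mem_parabolic_of_mem_cosetReps hd)).symm _

section Lex

variable {α : Type*} [DecidableEq α]

theorem ties_lex (φ : Fin (m + 1) → α) (u : Orb i) :
    ties (fun j => toLex (φ j, u.1 j)) = stab (ties φ) u := by
  ext r
  simp [mem_ties, stab]

variable [PartialOrder α] {φ : Fin (m + 1) → α}

theorem monotone_lex {β : Type*} [Preorder β] (hφ : Monotone φ) {χ : Fin (m + 1) → β}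
    (hχ : ∀ r ∈ ties φ, χ r.castSucc ≤ χ r.succ) : Monotone fun j => toLex (φ j, χ j) := by
  rw [Fin.monotone_iff_le_succ]
  intro r
  rw [Prod.Lex.toLex_le_toLex]
  rcases (hφ (Fin.castSucc_le_succ r)).lt_or_eq with hlt | htie
  · exact Or.inl hlt
  · exact Or.inr ⟨htie, hχ r (mem_ties.2 htie)⟩

variable {u : Orb i} {w : Equiv.Perm (Fin (m + 1))}

theorem mem_parabolic_stab (hφ : Monotone φ) (hu : u ∈ U (ties φ)) :
    w ∈ parabolic (stab (ties φ) u) ↔ w ∈ parabolic (ties φ) ∧ w • u = u := by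
  rw [← ties_lex, mem_parabolic_ties (monotone_lex hφ hu), mem_parabolic_ties hφ,
    smul_eq_self_iff, ← forall_and]
  exact forall_congr' fun j => by simp

theorem xi_apply_smul (hφ : Monotone φ) (hu : u ∈ U (ties φ)) {g : PS k m}
    (hg : ∀ w ∈ parabolic (stab (ties φ) u), permPS k w g = g) (hw : w ∈ parabolic (ties φ)) :
    xi (ties φ) u g (w • u) = permPS k w g := by
  classical
  obtain ⟨d, hd, v, hv, rfl⟩ := exists_mem_cosetReps_mul (J := stab (ties φ) u)
    (Finset.filter_subset _ _) hw
  rw [← permPS_mul, hg v hv, mul_smul, ((mem_parabolic_stab hφ hu).1 hv).2, xi,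
    Finset.sum_apply, Finset.sum_eq_single_of_mem d hd, Pi.single_eq_same]
  refine fun d' hd' hne => Pi.single_eq_of_ne (fun hdu => hne ?_) _
  rw [← ties_lex] at hd hd'
  refine eq_of_mem_cosetReps (monotone_lex hφ hu) hd' hd ?_
  rw [ties_lex, mem_parabolic_stab hφ hu, mul_smul, hdu, inv_smul_smul]
  exact ⟨mul_mem (inv_mem (mem_parabolic_of_mem_cosetReps hd'))
    (mem_parabolic_of_mem_cosetReps hd), rfl⟩

theorem perm_eq_of_mem_Rhat (hφ : Monotone φ) (hu : u ∈ U (ties φ)) {f : PolyRep i}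
    (hf : f ∈ Rhat (ties φ) u) (hw : w ∈ parabolic (ties φ)) : perm w f = f := by
  funext v
  rw [perm_apply]
  by_cases h : ∃ x ∈ parabolic (ties φ), x • u = v
  · obtain ⟨g, hg, rfl⟩ := hf
    obtain ⟨x, hx, rfl⟩ := h
    rw [← mul_smul, xi_apply_smul hφ hu hg (mul_mem (inv_mem hw) hx), xi_apply_smul hφ hu hg hx,
      permPS_mul, mul_inv_cancel_left]
  · have hv : f v = 0 := by_contra fun hne => h (exists_smul_of_apply_ne_zero hf hne)
    have hwv : f (w⁻¹ • v) = 0 := by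
      by_contra hne
      obtain ⟨x, hx, hxv⟩ := exists_smul_of_apply_ne_zero hf hne
      exact h ⟨w * x, mul_mem hw hx, by rw [mul_smul, hxv, smul_inv_smul]⟩
    rw [hv, hwv, map_zero]

end Lex

theorem mem_Rhat_univ {u : Orb i} (hu : u ∈ U (Finset.univ : Finset (Fin m))) {f : PolyRep i}
    (hf : ∀ w, perm w f = f) : f ∈ Rhat Finset.univ u := by
  have hsmul (w : Equiv.Perm (Fin (m + 1))) : f (w • u) = permPS k w (f u) := by
    conv_lhs => rw [← hf w]
    rw [perm_apply, inv_smul_smul]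
  rw [← ties_const ()] at hu ⊢
  have hinv : ∀ w ∈ parabolic (stab (ties fun _ => ()) u), permPS k w (f u) = f u := fun w hw => by
    rw [← hsmul, ((mem_parabolic_stab monotone_const hu).1 hw).2]
  refine ⟨f u, hinv, funext fun v => ?_⟩
  obtain ⟨w, rfl⟩ := exists_smul_eq u v
  rw [hsmul, xi_apply_smul monotone_const hu hinv]
  exact ties_const () ▸ mem_parabolic_univ w

theorem single_mem_twistedRep {u : Orb i} (hu : u ∈ U (Finset.univ : Finset (Fin m)))
    {f : PolyRep i} (hf : ∀ w, perm w f = f) :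
    (Pi.single Finset.univ f : Finset (Fin m) → PolyRep i) ∈ twistedRep i := by
  rw [twistedRep, Submodule.mem_pi]
  intro L _
  rcases eq_or_ne L Finset.univ with rfl | hL
  · rw [Pi.single_eq_same]
    exact Submodule.subset_span (Set.mem_biUnion hu (mem_Rhat_univ hu hf))
  · rw [Pi.single_eq_of_ne hL]
    exact zero_mem _

end Invariants

/-! ### Young subgroups -/

section Young

variable {m : ℕ} {α : Type*}

theorem mem_iff_lt_card_of_isLowerSet {A : Finset (Fin (m + 1))}
    (hA : IsLowerSet (A : Set (Fin (m + 1)))) (j : Fin (m + 1)) : j ∈ A ↔ (j : ℕ) < A.card := by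
  constructor
  · intro hj
    have hcard := Finset.card_le_card (show Finset.Iic j ⊆ A from fun l hl =>
      hA (Finset.mem_Iic.1 hl) hj)
    rw [Fin.card_Iic] at hcard
    omega
  · intro hj
    by_contra hjA
    have hcard := Finset.card_le_card (show A ⊆ Finset.Iio j from fun l hl =>
      Finset.mem_Iio.2 (lt_of_not_ge fun hjl => hjA (hA hjl hl)))
    rw [Fin.card_Iio] at hcard
    omega

theorem card_eq_succ_iff_of_isLowerSet {A : Finset (Fin (m + 1))}
    (hA : IsLowerSet (A : Set (Fin (m + 1)))) (r : Fin m) :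
    A.card = (r : ℕ) + 1 ↔ r.castSucc ∈ A ∧ r.succ ∉ A := by
  rw [mem_iff_lt_card_of_isLowerSet hA, mem_iff_lt_card_of_isLowerSet hA, Fin.val_castSucc,
    Fin.val_succ]
  omega

theorem sum_card_fibres [DecidableEq α] (φ : Fin (m + 1) → α) {l : List α} (hl : l.Nodup) :
    (l.map fun c => (Finset.univ.filter fun j => φ j = c).card).sum =
      (Finset.univ.filter fun j => φ j ∈ l).card := by
  simp_rw [← List.sum_toFinset _ hl, Finset.sum_card_fiberwise_eq_card_filter, List.mem_toFinset]

theorem mem_ofType {t : List ℕ} {r : Fin m} :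
    r ∈ ofType t ↔ ∀ p, (t.take p).sum ≠ (r : ℕ) + 1 := by
  classical
  exact Finset.mem_filter_univ r

variable [PartialOrder α] {l : List α}

theorem mem_take_of_le (hl : l.Pairwise (· < ·)) {x y : α} (hxy : x ≤ y) (hx : x ∈ l) {p : ℕ}
    (hy : y ∈ l.take p) : x ∈ l.take p := by
  rw [← List.take_append_drop p l] at hl hx
  exact (List.mem_append.1 hx).resolve_right fun hx =>
    ((List.pairwise_append.1 hl).2.2 y hy x hx).not_ge hxy

theorem exists_take_separating (hl : l.Pairwise (· < ·)) {x y : α} (hxy : x < y) (hx : x ∈ l) :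
    ∃ p, x ∈ l.take p ∧ y ∉ l.take p := by
  obtain ⟨l₁, l₂, rfl⟩ := List.append_of_mem hx
  refine ⟨l₁.length + 1, by simp [List.take_append], ?_⟩
  have hlt := (List.pairwise_append.1 hl).2.2
  simp only [List.take_length_add_append, List.take_succ_cons, List.take_zero, List.mem_append,
    List.mem_singleton]
  rintro (hy | rfl)
  · exact (hlt y hy x List.mem_cons_self).not_gt hxy
  · exact hxy.false

theorem ofType_card_fibres [DecidableEq α] {φ : Fin (m + 1) → α} (hφ : Monotone φ)
    (hl : l.Pairwise (· < ·)) (hmem : ∀ j, φ j ∈ l) :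
    ofType (l.map fun c => (Finset.univ.filter fun j => φ j = c).card) = ties φ := by
  have hlower (p : ℕ) :
      IsLowerSet (Finset.univ.filter fun j => φ j ∈ l.take p : Set (Fin (m + 1))) := by
    intro j j' hle hj
    rw [Finset.mem_coe, Finset.mem_filter_univ] at hj ⊢
    exact mem_take_of_le hl (hφ hle) (hmem j') hj
  ext r
  simp only [mem_ofType, mem_ties, ← List.map_take, ne_eq,
    sum_card_fibres φ ((List.take_sublist _ l).nodup (hl.imp ne_of_lt)),
    card_eq_succ_iff_of_isLowerSet (hlower _), Finset.mem_filter_univ]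
  refine ⟨fun h => by_contra fun hne => ?_, fun htie p h => h.2 (htie ▸ h.1)⟩
  obtain ⟨p, hp⟩ := exists_take_separating hl
    ((hφ (Fin.castSucc_le_succ r)).lt_of_ne hne) (hmem r.castSucc)
  exact h p hp

end Young

section Multiplicities

variable {k : Type*} [Field k] {q : kˣ} {m : ℕ} {i : Fin (m + 1) → Residue q} {u v : Orb i}
  {σ : Equiv.Perm (Fin (m + 1))}

theorem mem_entries (u : Orb i) (j : Fin (m + 1)) : u.1 j ∈ entries i := by
  obtain ⟨w, hw⟩ := u.2
  rw [entries, Finset.mem_sort, hw]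
  exact Finset.mem_image_of_mem _ (Finset.mem_univ _)

theorem entries_pairwise : (entries i).Pairwise (· < ·) := (Finset.sortedLT_sort _).pairwise

theorem ofType_multiplicities (hu : Monotone u.1) : ofType (multiplicities u) = ties u.1 :=
  ofType_card_fibres hu entries_pairwise (mem_entries u)

theorem card_fibre_lex {α : Type*} [DecidableEq α] (φ : Fin (m + 1) → α) (hσ : σ • u = v)
    (c : Residue q) (b : α) :
    (Finset.univ.filter fun j => toLex (v.1 j, φ (σ⁻¹ j)) = toLex (c, b)).card =
      (Finset.univ.filter fun j => φ j = b ∧ u.1 j = c).card := by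
  refine Finset.card_equiv σ⁻¹ fun j => ?_
  rw [Finset.mem_filter_univ, Finset.mem_filter_univ, toLex_inj, Prod.mk.injEq, ← hσ, smul_apply,
    and_comm]

theorem ofType_splitMultiplicities (a : Fin m) (hσ : σ • u = v)
    (hmono : Monotone fun j => toLex (v.1 j, side a (σ⁻¹ j))) :
    ofType (splitMultiplicities a u) = ties fun j => toLex (v.1 j, side a (σ⁻¹ j)) := by
  rw [← ofType_card_fibres (l := (entries i).flatMap fun c => [toLex (c, false), toLex (c, true)])
    hmono]
  · simp only [splitMultiplicities, List.map_flatMap, List.map_cons, List.map_nil,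
      card_fibre_lex (side a) hσ]
    simp [side]
  · rw [List.pairwise_flatMap]
    refine ⟨fun c _ => by simp [Prod.Lex.toLex_lt_toLex], entries_pairwise.imp fun hlt => ?_⟩
    simp [Prod.Lex.toLex_lt_toLex, hlt]
  · intro j
    refine List.mem_flatMap.2 ⟨v.1 j, mem_entries v j, ?_⟩
    cases side a (σ⁻¹ j) <;> simp

theorem monotone_lex_of_minimal {α : Type*} [Preorder α] {φ : Fin (m + 1) → α}
    (hφ : Monotone φ) (hv : Monotone v.1) (hσ : σ • u = v)
    (hmin : ∀ w : Equiv.Perm (Fin (m + 1)), w • u = v → len σ ≤ len w) :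
    Monotone fun j => toLex (v.1 j, φ (σ⁻¹ j)) := by
  refine monotone_lex hv fun r hr => hφ (le_of_lt ?_)
  refine (apply_castSucc_lt_or_gt σ⁻¹ r).resolve_right fun hgt => ?_
  have hle := hmin (s r * σ) (by
    rw [mul_smul, hσ, smul_eq_self_iff]
    exact apply_s_of_eq (mem_ties.1 hr))
  have hlen := len_s_mul_of_gt hgt
  omega

end Multiplicities

/-! ### Localisation at the sorted sequence -/

section Localisation

variable {k : Type*} [Field k] {q : kˣ} {m : ℕ} {i : Fin (m + 1) → Residue q} {u v : Orb i}
  {σ w : Equiv.Perm (Fin (m + 1))} {α : Type*} [DecidableEq α] [PartialOrder α]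
  {φ : Fin (m + 1) → α}

theorem mem_parabolic_ties_lex (hφ : Monotone φ) (hv : Monotone v.1)
    (hlex : Monotone fun j => toLex (v.1 j, φ (σ⁻¹ j))) :
    w ∈ parabolic (ties fun j => toLex (v.1 j, φ (σ⁻¹ j))) ↔
      w ∈ parabolic (ties v.1) ∧ σ⁻¹ * w * σ ∈ parabolic (ties φ) := by
  rw [mem_parabolic_ties hlex, mem_parabolic_ties hv, mem_parabolic_ties hφ]
  simp only [toLex_inj, Prod.mk.injEq, forall_and]
  refine and_congr_right fun _ => ⟨fun h j => by simpa using h (σ j), fun h j => ?_⟩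
  simpa using h (σ⁻¹ j)

theorem exists_eq_mul_of_permF_apply_ne_zero (hφ : Monotone φ) (hv : Monotone v.1)
    (hσ : σ • u = v) (hlex : Monotone fun j => toLex (v.1 j, φ (σ⁻¹ j))) {F : FracRep i}
    (hsupp : ∀ u', F u' ≠ 0 → ∃ y ∈ parabolic (ties φ), y • u = u') (hw : permF w F v ≠ 0) :
    ∃ x ∈ cosetReps (ties v.1) (ties fun j => toLex (v.1 j, φ (σ⁻¹ j))),
      ∃ y ∈ parabolic (ties φ), w = x * σ * y := by
  obtain ⟨y, hy, hyu⟩ := hsupp (w⁻¹ • v) fun h0 => hw (by rw [permF_apply, h0, map_zero])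
  have hstab : w * y * σ⁻¹ ∈ parabolic (ties v.1) := by
    rw [mem_parabolic_ties hv, ← smul_eq_self_iff, mul_smul, mul_smul, ← hσ, inv_smul_smul, hyu,
      hσ, smul_inv_smul]
  have hsub : ties (fun j => toLex (v.1 j, φ (σ⁻¹ j))) ⊆ ties v.1 := fun r hr =>
    mem_ties.2 (Prod.ext_iff.1 (mem_ties.1 hr)).1
  obtain ⟨x, hx, z, hz, hxz⟩ := exists_mem_cosetReps_mul hsub hstab
  refine ⟨x, hx, σ⁻¹ * z * σ * y⁻¹,
    mul_mem ((mem_parabolic_ties_lex hφ hv hlex).1 hz).2 (inv_mem hy), ?_⟩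
  rw [show w = w * y * σ⁻¹ * σ * y⁻¹ by group, hxz]
  group

theorem sum_permF_cosetReps_apply (hφ : Monotone φ) (hv : Monotone v.1) (hσ : σ • u = v)
    (hlex : Monotone fun j => toLex (v.1 j, φ (σ⁻¹ j))) {F : FracRep i}
    (hF : ∀ y ∈ parabolic (ties φ), permF y F = F)
    (hsupp : ∀ u', F u' ≠ 0 → ∃ y ∈ parabolic (ties φ), y • u = u') :
    (∑ d ∈ cosetReps Finset.univ (ties φ), permF d F) v =
      (∑ x ∈ cosetReps (ties v.1) (ties fun j => toLex (v.1 j, φ (σ⁻¹ j))),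
        permF x (permF σ F)) v := by
  choose d hd y hy hdy using fun x => exists_mem_cosetReps_mul (J := ties φ)
    (Finset.subset_univ _) (mem_parabolic_univ (x * σ))
  rw [Finset.sum_apply, Finset.sum_apply]
  refine (Finset.sum_of_injOn d (fun x hx x' hx' hxx' => ?_) (fun x _ => hd x) ?_ ?_).symm
  · refine eq_of_mem_cosetReps hlex hx hx' ((mem_parabolic_ties_lex hφ hv hlex).2
      ⟨mul_mem (inv_mem (mem_parabolic_of_mem_cosetReps hx)) (mem_parabolic_of_mem_cosetReps hx'),
        ?_⟩)
    rw [show σ⁻¹ * (x⁻¹ * x') * σ = (x * σ)⁻¹ * (x' * σ) by group, hdy, hdy x', hxx',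
      show (d x' * y x)⁻¹ * (d x' * y x') = (y x)⁻¹ * y x' by group]
    exact mul_mem (inv_mem (hy x)) (hy x')
  · intro w hw hnot
    by_contra hne
    obtain ⟨x, hx, z, hz, rfl⟩ := exists_eq_mul_of_permF_apply_ne_zero hφ hv hσ hlex hsupp hne
    refine hnot ⟨x, hx, eq_of_mem_cosetReps hφ (hd x) hw ?_⟩
    rw [hdy, mul_assoc, inv_mul_cancel_left]
    exact mul_mem (hy x) hz
  · intro x _
    rw [permF_permF, hdy, ← permF_permF, hF _ (hy x)]

theorem toFrac_hatAct_apply_sorted (hφ : Monotone φ) (hu : u ∈ U (ties φ)) (hv : Monotone v.1)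
    (hσ : σ • u = v) (hlex : Monotone fun j => toLex (v.1 j, φ (σ⁻¹ j))) {x : HeckeHat i}
    (hx : x * toHat i (vHash q (ties φ)) = toHat i (vHash q Finset.univ)) {f : PolyRep i}
    (hf : f ∈ Rhat (ties φ) u) :
    toFrac (hatAct i x f) v =
      (∑ w ∈ cosetReps (ties v.1) (ties fun j => toLex (v.1 j, φ (σ⁻¹ j))),
        permF w (permF σ (crossTheta i φ (fun _ => ()) * toFrac f))) v := by
  have hinv (w) (hw : w ∈ parabolic (ties φ)) : perm w f = f := perm_eq_of_mem_Rhat hφ hu hf hw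
  have hsub : ties φ ⊆ ties fun _ : Fin (m + 1) => () := ties_const () ▸ Finset.subset_univ _
  rw [← ties_const ()] at hx
  rw [toFrac_hatAct hφ monotone_const hsub hx hinv, ties_const,
    sum_permF_cosetReps_apply hφ hv hσ hlex]
  · intro y hy
    rw [map_mul, permF_crossTheta hφ monotone_const hsub hy, permF_toFrac y f, hinv y hy]
  · intro u' hu'
    refine exists_smul_of_apply_ne_zero hf fun h0 => hu' ?_
    rw [Pi.mul_apply, toFrac_apply, h0, map_zero, mul_zero]

end Localisation

end

end AffineSchur

theorem mainTheorem6 {k : Type*} [Field k] (q : kˣ) (hq : q ≠ 1) {m : ℕ}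
    (i : Fin (m + 1) → Residue q) (a : Fin m) (uJ uK : Orb i)
    (huJ : uJ ∈ U (Finset.univ.erase a)) (huK : uK ∈ U Finset.univ)
    (σ : Equiv.Perm (Fin (m + 1)))
    (hσ : σ • uJ = uK ∧ ∀ w : Equiv.Perm (Fin (m + 1)), w • uJ = uK → len σ ≤ len w) :
    ∃ b : SchurHat i,
      (∀ b' : SchurHat i, IsBasisOne Finset.univ (Finset.univ.erase a) b' ↔ b' = b) ∧
      ∀ f ∈ Rhat (Finset.univ.erase a) uJ,
        rho b (Pi.single (Finset.univ.erase a) f) ∈ twistedRep i ∧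
        (fun L => toFrac (rho b (Pi.single (Finset.univ.erase a) f) L) uK) =
          Pi.single (Finset.univ : Finset (Fin m))
            (symmetrise (multiplicities uK) (splitMultiplicities a uJ)
              (permF σ
                ((∏ l ∈ Finset.Ioi a.castSucc, ∏ j ∈ Finset.Iic a.castSucc, theta i j l) *
                  toFrac f)) uK) := by
  obtain ⟨hσ, hmin⟩ := hσ
  rw [← ties_side] at huJ ⊢
  have hφ := side_monotone a
  have hJK := Finset.subset_univ (ties (side a))
  have hh := congrArg (toHat i) (vHash_eq_mul_vHash_ties q hφ hJK).symm
  rw [map_mul] at hh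
  obtain ⟨b, hb⟩ := exists_isBasisOne hJK hh
  refine ⟨b, fun b' => ⟨fun hb' => hb'.unique hb, fun h => h ▸ hb⟩, fun f hf => ?_⟩
  have hinv (w) (hw : w ∈ parabolic (ties (side a))) : perm w f = f :=
    perm_eq_of_mem_Rhat hφ huJ hf hw
  have hcoeff := hb.coeffHat_mul_self hJK hh
  rw [hb.rho_single hφ hJK hh hinv]
  refine ⟨single_mem_twistedRep huK fun w =>
    perm_hatAct hφ hcoeff hinv (mem_parabolic_univ w), funext fun L => ?_⟩
  rcases eq_or_ne L Finset.univ with rfl | hL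
  · have huK_mono : Monotone uK.1 := Fin.monotone_iff_le_succ.2 fun r => huK r (Finset.mem_univ r)
    have hlex := monotone_lex_of_minimal hφ huK_mono hσ hmin
    rw [Pi.single_eq_same, Pi.single_eq_same, symmetrise, ofType_multiplicities huK_mono,
      ofType_splitMultiplicities a hσ hlex, ← crossTheta_side,
      toFrac_hatAct_apply_sorted hφ huJ huK_mono hσ hlex hcoeff hf]
  · rw [Pi.single_eq_of_ne hL, Pi.single_eq_of_ne hL, map_zero, Pi.zero_apply]
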